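/- For $f\in\mathcal S(\mathbb R^n)$ write $\widehat f(\xi)=\int_{\mathbb R^n}e^{-ix\cdot\xi}f(x)\,dx$ and $$e^{it\Delta}f(x)=\frac1{(2\pi)^n}\int_{\mathbb R^n}e^{ix\cdot\xi-it|\xi|^2}\widehat f(\xi)\,d\xi .$$ For $s\in\mathbb R$ and $1\le p<\infty$ let $L^p_s(\mathbb R^n)$ be the Bessel potential space of all tempered distributions $f$ with $((1+|\cdot|^2)^{s/2}\widehat f)^\vee\in L^p(\mathbb R^n)$, with norm $\|f\|_{L^p_s}=\|((1+|\cdot|^2)^{s/2}\widehat f)^\vee\|_{L^p}$, where $^\vee$ is the inverse Fourier transform. For $1\le q<\infty$ and a measurable function $F\ge 0$ on the unit ball $B(0,1)\subset\mathbb R^n$ let $\|F\|_{L^{q,\infty}(B(0,1))}=\sup_{\delta>0}\delta\,|\{x\in B(0,1):F(x)>\delta\}|^{1/q}$. **Theorem 1.8.** Let $1\le p<\infty$, $1\le q<\infty$, $n\ge 1$ and $s\in\mathbb R$, and suppose that one of the following holds: 1. $n=1$ and $s<\frac1{2p}$; 2. $n\ge2$, $1\le p<2$ and $s<n\left(\frac1p-\frac12\right)$;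 3. $n\ge2$, $2\le p<\frac{2n-1}{n-1}$ and $s<\left(\frac12-n\right)\left(\frac12-\frac1p\right)+\frac14$. Then the estimate $$\Big\|\sup_{0<t<1}|e^{it\Delta}f|\Big\|_{L^{q,\infty}(B(0,1))}\le C\,\|f\|_{L^p_s(\mathbb R^n)}$$ does not hold for all $f\in L^p_s(\mathbb R^n)$ with any finite constant $C$ independent of $f$; in fact, no such $C$ works even for all Schwartz functions $f$, all of which lie in $L^p_s(\mathbb R^n)$. -/

import Mathlib

open MeasureTheory
open scoped ENNReal NNReal SchwartzMap

noncomputable section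

/-- The Fourier transform `f̂(ξ) = ∫ e^{-i x·ξ} f(x) dx` on `ℝⁿ`. -/
def fourierHat {n : ℕ} (f : EuclideanSpace ℝ (Fin n) → ℂ) (ξ : EuclideanSpace ℝ (Fin n)) : ℂ :=
  ∫ x, Complex.exp (-(Complex.I * ((inner ℝ x ξ : ℝ) : ℂ))) * f x

/-- The Schrödinger evolution
`e^{itΔ} f (x) = (2π)^{-n} ∫ e^{i x·ξ - i t |ξ|²} f̂(ξ) dξ`. -/
def schrodingerEvol {n : ℕ} (t : ℝ) (f : EuclideanSpace ℝ (Fin n) → ℂ)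
    (x : EuclideanSpace ℝ (Fin n)) : ℂ :=
  (((2 * Real.pi) ^ n)⁻¹ : ℝ) *
    ∫ ξ, Complex.exp (Complex.I * ((inner ℝ x ξ - t * ‖ξ‖ ^ 2 : ℝ) : ℂ)) * fourierHat f ξ

/-- The maximal function `sup_{0<t<1} |e^{itΔ} f (x)|`. -/
def schrodingerMaximal {n : ℕ} (f : EuclideanSpace ℝ (Fin n) → ℂ)
    (x : EuclideanSpace ℝ (Fin n)) : ℝ≥0∞ :=
  ⨆ t ∈ Set.Ioo (0 : ℝ) 1, ‖schrodingerEvol t f x‖ₑ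

/-- The weak Lebesgue quasinorm
`‖F‖_{L^{q,∞}(S)} = sup_{δ>0} δ |{x ∈ S : F(x) > δ}|^{1/q}` of a nonnegative function. -/
def weakNormOn {n : ℕ} (q : ℝ) (S : Set (EuclideanSpace ℝ (Fin n)))
    (F : EuclideanSpace ℝ (Fin n) → ℝ≥0∞) : ℝ≥0∞ :=
  ⨆ δ : ℝ≥0, (δ : ℝ≥0∞) * (volume {x ∈ S | (δ : ℝ≥0∞) < F x}) ^ (1 / q)

/-- The operator `(1 - Δ)^{s/2}` on tempered distributions. In the normalization
`f̂(ξ) = ∫ e^{-i x·ξ} f(x) dx` its symbol is `(1 + |ξ|²)^{s/2}`; Mathlib's Fourier transform has the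
phase `e^{-2πi x·ξ}`, whence the factor `2π`. -/
def besselOp (n : ℕ) (s : ℝ) :
    𝓢'(EuclideanSpace ℝ (Fin n), ℂ) →L[ℂ] 𝓢'(EuclideanSpace ℝ (Fin n), ℂ) :=
  TemperedDistribution.fourierMultiplierCLM ℂ
    (fun ξ ↦ (((1 + (2 * Real.pi * ‖ξ‖) ^ 2) ^ (s / 2) : ℝ) : ℂ))

/-- The tempered distribution `T` is the function `g ∈ L^p(ℝⁿ)` (used for `p ≥ 1`). -/
def IsLpFunction {n : ℕ} (p : ℝ≥0∞) (T : 𝓢'(EuclideanSpace ℝ (Fin n), ℂ))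
    (g : EuclideanSpace ℝ (Fin n) → ℂ) : Prop :=
  MemLp g p ∧ ∀ φ : 𝓢(EuclideanSpace ℝ (Fin n), ℂ), T φ = ∫ x, φ x * g x

/-- Membership of a tempered distribution in the Bessel potential space `L^p_s(ℝⁿ)`. -/
def MemBesselSpace {n : ℕ} (s : ℝ) (p : ℝ≥0∞) (T : 𝓢'(EuclideanSpace ℝ (Fin n), ℂ)) : Prop :=
  ∃ g, IsLpFunction p (besselOp n s T) g

/-- The norm `‖T‖_{L^p_s} = ‖(1 - Δ)^{s/2} T‖_{L^p}`. The function `g` representing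
`(1 - Δ)^{s/2} T` is unique up to null sets, so the infimum is just its `L^p` norm; it is `∞` when
`T` is not in `L^p_s`. -/
def besselNorm {n : ℕ} (s : ℝ) (p : ℝ≥0∞) (T : 𝓢'(EuclideanSpace ℝ (Fin n), ℂ)) : ℝ≥0∞ :=
  ⨅ (g : EuclideanSpace ℝ (Fin n) → ℂ) (_ : IsLpFunction p (besselOp n s T) g), eLpNorm g p

end

/-! The estimate is tested on wave packets `f` for which the Fourier transform of `(1 - Δ)^{s/2} f`
is a Gaussian adapted to `ξ₀ + A(B)`, with `B` the unit ball and `A` a self-adjoint isomorphism. The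
`L^p_s` norm of `f` is then a constant times `(jac A)^{1-1/p}`. If the symbol is nearly constant on
the packet, `e^{itΔ} f` is essentially `jac A · |ξ₀|^{-s}` times an explicit oscillatory Gaussian
integral. If that integral exceeds `δ`, at times depending on the point, on a set of measure `μ` in
the unit ball, the estimate forces `δ μ^{1/q} (jac A)^{1/p} |ξ₀|^{-s} ≲ 1`
(`WeakMaximalEstimate.exists_bound`). Two families, with `a → ∞`, contradict this.

Travelling packet: frequency `a² e`, bandwidth `a` along `e` and `1` across. It moves with speed
comparable to `a²` and passes every point of a fixed open set before it disperses, so `δ` and `μ`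
are constants and `jac A = a`. Hence `a^{1/p-2s} ≲ 1`, that is, `s ≥ 1/(2p)`.

Spreading packet: frequency `R = a^κ`, `1 < κ < 2`, bandwidth `a` in all directions. At time
`1/(8πR)` it fills a large part of a ball of radius `a/(2R)` with height `δ ≈ (R/a²)^{n/2}`, while
`jac A = a^n`. Letting `κ → 1` gives `s ≥ n(1/p - 1/2)`, whatever `q` is. Here `κ > 1` makes the
symbol asymptotically constant on the packet, and `κ < 2` makes the packet spread.

Freezing the symbol costs an error controlled by dominated convergence. It is pointwise small for
the travelling packet. For the spreading one the main term itself tends to zero, so the error is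
estimated in `L²` by Plancherel and Chebyshev, and a small exceptional set is discarded. The first
family settles cases 1 and 3, the second settles case 2. -/

open Real Filter Topology
open scoped FourierTransform

/-! ### The Gaussian as a Schwartz function -/

section

open scoped ContDiff Nat

/-- The function `y ↦ e^{iy}` has temperate growth. -/
theorem hasTemperateGrowth_cexp_ofReal_mul_I :
    (fun y : ℝ ↦ Complex.exp (y * Complex.I)).HasTemperateGrowth := by
  have hd : deriv (fun y : ℝ ↦ Complex.exp (y * Complex.I))
      = fun y : ℝ ↦ Complex.I * Complex.exp (y * Complex.I) := by
    funext y
    have h : HasDerivAt (fun y : ℝ ↦ (y : ℂ) * Complex.I) (1 * Complex.I) y :=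
      (Complex.ofRealCLM.hasDerivAt (x := y)).mul_const Complex.I
    rw [h.cexp.deriv]; ring
  have hi : ∀ n : ℕ, iteratedDeriv n (fun y : ℝ ↦ Complex.exp (y * Complex.I))
      = fun y : ℝ ↦ Complex.I ^ n * Complex.exp (y * Complex.I) := by
    intro n
    induction n with
    | zero => simp
    | succ k ih =>
      rw [iteratedDeriv_succ, ih]
      funext y
      rw [deriv_const_mul_field, hd, pow_succ]; ring
  refine ⟨((Complex.ofRealCLM.contDiff).mul contDiff_const).cexp, fun n ↦ ⟨0, 1, fun x ↦ ?_⟩⟩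
  rw [norm_iteratedFDeriv_eq_norm_iteratedDeriv, hi]
  simp [Complex.norm_exp_ofReal_mul_I]

section Gaussian

variable {V : Type*} [NormedAddCommGroup V] [InnerProductSpace ℝ V]

theorem pow_one_add_mul_exp_neg_sq_le (m : ℕ) :
    ∃ C : ℝ, ∀ r : ℝ, 0 ≤ r → (1 + r) ^ m * rexp (-π * r ^ 2) ≤ C := by
  refine ⟨m ! * rexp 2, fun r hr ↦ ?_⟩
  have h1 := Real.pow_div_factorial_le_exp (1 + r) (by positivity) m
  rw [div_le_iff₀ (by positivity)] at h1
  calc (1 + r) ^ m * rexp (-π * r ^ 2)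
      ≤ (rexp (1 + r) * m !) * rexp (-π * r ^ 2) := by gcongr
    _ = m ! * rexp (1 + r + -π * r ^ 2) := by rw [Real.exp_add (1 + r)]; ring
    _ ≤ m ! * rexp 2 := by
      gcongr
      nlinarith [Real.pi_gt_three, sq_nonneg (2 * r - 1)]

variable (V) in
/-- The Gaussian `v ↦ e^{-π ‖v‖²}` as a Schwartz function. -/
noncomputable def gaussianSchwartz : 𝓢(V, ℂ) where
  toFun v := (rexp (-π * ‖v‖ ^ 2) : ℂ)
  smooth' := by
    have : ContDiff ℝ ∞ (fun v : V ↦ rexp (-π * ‖v‖ ^ 2)) :=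
      (contDiff_const.mul (contDiff_norm_sq ℝ)).exp
    exact Complex.ofRealCLM.contDiff.comp this
  decay' k n := by
    have hq : (fun v : V ↦ -π * ‖v‖ ^ 2).HasTemperateGrowth := by fun_prop
    obtain ⟨l, C, hC, h⟩ := hq.norm_iteratedFDeriv_le_uniform n
    obtain ⟨B, hB⟩ := pow_one_add_mul_exp_neg_sq_le (k + l * n)
    refine ⟨n ! * (1 + C) ^ n * B, fun v ↦ ?_⟩
    have h1 : ‖iteratedFDeriv ℝ n (fun v : V ↦ ((rexp (-π * ‖v‖ ^ 2) : ℝ) : ℂ)) v‖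
        = ‖iteratedFDeriv ℝ n (fun v : V ↦ rexp (-π * ‖v‖ ^ 2)) v‖ :=
      Complex.ofRealLI.norm_iteratedFDeriv_comp_left
        (f := fun v : V ↦ rexp (-π * ‖v‖ ^ 2))
        ((contDiff_const.mul (contDiff_norm_sq ℝ)).exp.contDiffAt) (n := n) le_rfl
    -- Faà di Bruno bound: derivatives of the exponential reproduce it, and those of the quadratic
    -- exponent grow polynomially.
    have h2 : ‖iteratedFDeriv ℝ n (rexp ∘ (fun v : V ↦ -π * ‖v‖ ^ 2)) v‖
        ≤ n ! * rexp (-π * ‖v‖ ^ 2) * ((1 + C) * (1 + ‖v‖) ^ l) ^ n := by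
      refine norm_iteratedFDeriv_comp_le (N := n) Real.contDiff_exp
        (contDiff_const.mul (contDiff_norm_sq ℝ)) le_rfl v (fun i _ ↦ ?_) (fun i hi hi' ↦ ?_)
      · rw [norm_iteratedFDeriv_eq_norm_iteratedDeriv, iteratedDeriv_eq_iterate, Real.iter_deriv_exp]
        simp
      · calc _ ≤ C * (1 + ‖v‖) ^ l := h i hi' v
          _ ≤ (1 + C) * (1 + ‖v‖) ^ l := by gcongr; simp
          _ ≤ _ := by
            apply le_self_pow₀ (one_le_mul_of_one_le_of_one_le (by simp [hC]) (by simp [one_le_pow₀]))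
            grind
    rw [h1]
    calc ‖v‖ ^ k * _ ≤ (1 + ‖v‖) ^ k * (n ! * rexp (-π * ‖v‖ ^ 2) * ((1 + C) * (1 + ‖v‖) ^ l) ^ n) := by
          gcongr
          · simp
          · exact h2
      _ = n ! * (1 + C) ^ n * ((1 + ‖v‖) ^ (k + l * n) * rexp (-π * ‖v‖ ^ 2)) := by
          rw [mul_pow, ← pow_mul, pow_add]; ring
      _ ≤ _ := by gcongr; exact hB _ (norm_nonneg v)

theorem gaussianSchwartz_apply (v : V) : gaussianSchwartz V v = (rexp (-π * ‖v‖ ^ 2) : ℂ) := rfl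

theorem norm_gaussianSchwartz (v : V) : ‖gaussianSchwartz V v‖ = rexp (-π * ‖v‖ ^ 2) := by
  rw [gaussianSchwartz_apply, Complex.norm_real, Real.norm_of_nonneg (Real.exp_pos _).le]

variable [FiniteDimensional ℝ V] [MeasurableSpace V] [BorelSpace V]

theorem integrable_pow_mul_gaussian (m : ℕ) :
    Integrable (fun v : V ↦ ‖v‖ ^ m * rexp (-π * ‖v‖ ^ 2)) := by
  simpa only [norm_gaussianSchwartz] using (gaussianSchwartz V).integrable_pow_mul volume m

theorem integrable_gaussian : Integrable (fun v : V ↦ rexp (-π * ‖v‖ ^ 2)) := by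
  simpa using integrable_pow_mul_gaussian (V := V) 0

theorem integral_gaussian_eq_one : ∫ v : V, rexp (-π * ‖v‖ ^ 2) = 1 := by
  rw [GaussianFourier.integral_rexp_neg_mul_sq_norm pi_pos, div_self pi_ne_zero, one_rpow]

theorem fourierInv_gaussianSchwartz : 𝓕⁻ (gaussianSchwartz V) = gaussianSchwartz V := by
  have h : 𝓕 (gaussianSchwartz V) = gaussianSchwartz V := by
    ext w
    rw [SchwartzMap.fourier_coe]
    have := fourier_gaussian_innerProductSpace (V := V) (b := (π : ℂ)) (by simpa using pi_pos) w
    have hf : ⇑(gaussianSchwartz V) = fun v : V ↦ Complex.exp (-π * ‖v‖ ^ 2) := by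
      funext v
      simp [gaussianSchwartz_apply]
    rw [hf, this]
    have hp : (π : ℂ) ≠ 0 := by exact_mod_cast pi_ne_zero
    rw [div_self hp, Complex.one_cpow, one_mul]
    congr 1
    field_simp
  nth_rw 1 [← h]
  exact FourierTransform.fourierInv_fourier_eq _

end Gaussian

end

/-! ### Affine changes of variables -/

section ChangeOfVariables

variable {V : Type*} [NormedAddCommGroup V] [InnerProductSpace ℝ V]

/-- The Jacobian of a linear isomorphism. -/
noncomputable def jac (A : V ≃L[ℝ] V) : ℝ := |LinearMap.det (A : V →ₗ[ℝ] V)|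

theorem jac_pos (A : V ≃L[ℝ] V) : 0 < jac A :=
  abs_pos.2 (LinearEquiv.isUnit_det' A.toLinearEquiv).ne_zero

variable [FiniteDimensional ℝ V] [MeasurableSpace V] [BorelSpace V]

theorem map_volume_eq_jac_inv_smul (A : V ≃L[ℝ] V) :
    Measure.map A (volume : Measure V) = ENNReal.ofReal (jac A)⁻¹ • (volume : Measure V) := by
  have h := Measure.map_linearMap_addHaar_eq_smul_addHaar (volume : Measure V)
    (f := (A : V →ₗ[ℝ] V)) (LinearEquiv.isUnit_det' A.toLinearEquiv).ne_zero
  rw [abs_inv] at h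
  exact h

theorem integral_comp_affine {F : Type*} [NormedAddCommGroup F] [NormedSpace ℝ F]
    (A : V ≃L[ℝ] V) (c : V) (f : V → F) :
    ∫ ξ, f ξ = jac A • ∫ η, f (c + A η) := by
  have h1 : ∫ η, f (c + A η) = ∫ y, f (c + y) ∂(Measure.map A (volume : Measure V)) :=
    (A.toHomeomorph.measurableEmbedding.integral_map (fun y ↦ f (c + y))).symm
  rw [h1, map_volume_eq_jac_inv_smul, integral_smul_measure,
    ENNReal.toReal_ofReal (inv_nonneg.2 (jac_pos A).le), smul_smul,
    mul_inv_cancel₀ (jac_pos A).ne', one_smul, integral_add_left_eq_self]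

theorem eLpNorm_comp_linear {F : Type*} [NormedAddCommGroup F] (A : V ≃L[ℝ] V) (f : V → F)
    {p : ℝ} (hp : 1 ≤ p) :
    eLpNorm (fun x ↦ f (A x)) (ENNReal.ofReal p) volume
      = ENNReal.ofReal (jac A ^ (-(1 / p))) * eLpNorm f (ENNReal.ofReal p) volume := by
  have h := A.toHomeomorph.measurableEmbedding.eLpNorm_map_measure
    (g := f) (p := ENNReal.ofReal p) (μ := (volume : Measure V))
  change eLpNorm f _ (Measure.map A volume) = eLpNorm (fun x ↦ f (A x)) _ _ at h
  rw [← h, map_volume_eq_jac_inv_smul, eLpNorm_smul_measure_of_ne_top ENNReal.ofReal_ne_top,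
    smul_eq_mul, ENNReal.toReal_div, ENNReal.toReal_one, ENNReal.toReal_ofReal (by linarith),
    ENNReal.ofReal_rpow_of_nonneg (inv_nonneg.2 (jac_pos A).le) (by positivity),
    inv_rpow (jac_pos A).le, rpow_neg (jac_pos A).le]

end ChangeOfVariables

/-! ### Wave packets and their Bessel norms -/

section WavePacket

variable {V : Type*} [NormedAddCommGroup V]

/-- The Bessel symbol `(1 + |2πξ|²)^{s/2}`. -/
noncomputable def besselSymbol (s : ℝ) (ξ : V) : ℝ := (1 + (2 * π * ‖ξ‖) ^ 2) ^ (s / 2)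

theorem besselSymbol_pos (s : ℝ) (ξ : V) : 0 < besselSymbol s ξ := by
  unfold besselSymbol; positivity

theorem besselSymbol_mul_neg (s : ℝ) (ξ : V) : besselSymbol s ξ * besselSymbol (-s) ξ = 1 := by
  unfold besselSymbol
  rw [← rpow_add (by positivity)]
  ring_nf
  exact rpow_zero _

theorem continuous_besselSymbol (s : ℝ) : Continuous (besselSymbol s : V → ℝ) := by
  unfold besselSymbol
  exact Continuous.rpow_const (by fun_prop) fun x ↦ Or.inl (by positivity)

variable [InnerProductSpace ℝ V]

theorem besselSymbol_hasTemperateGrowth (s : ℝ) :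
    (fun ξ : V ↦ ((besselSymbol s ξ : ℝ) : ℂ)).HasTemperateGrowth := by
  have h1 : (fun ξ : V ↦ (1 + ‖ξ‖ ^ 2) ^ (s / 2)).HasTemperateGrowth :=
    Function.hasTemperateGrowth_one_add_norm_sq_rpow V (s / 2)
  have h2 : (fun ξ : V ↦ (2 * π) • ξ).HasTemperateGrowth :=
    ((2 * π) • ContinuousLinearMap.id ℝ V).hasTemperateGrowth
  have h3 := Function.Complex.hasTemperateGrowth_ofReal.comp (h1.comp h2)
  have h4 : (fun ξ : V ↦ ((besselSymbol s ξ : ℝ) : ℂ))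
      = Complex.ofReal ∘ ((fun ξ : V ↦ (1 + ‖ξ‖ ^ 2) ^ (s / 2)) ∘ fun ξ : V ↦ (2 * π) • ξ) := by
    funext ξ
    simp [besselSymbol, norm_smul, abs_of_pos pi_pos]
  rwa [h4]

/-- The Gaussian bump adapted to the affine image `ξ₀ + A(B)` of the unit ball. -/
noncomputable def gaussianBump (A : V ≃L[ℝ] V) (ξ₀ : V) : 𝓢(V, ℂ) :=
  SchwartzMap.compSubConstCLM ℂ ξ₀
    (SchwartzMap.compCLMOfContinuousLinearEquiv ℂ A.symm (gaussianSchwartz V))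

theorem gaussianBump_apply (A : V ≃L[ℝ] V) (ξ₀ ξ : V) :
    gaussianBump A ξ₀ ξ = gaussianSchwartz V (A.symm (ξ - ξ₀)) := by
  simp [gaussianBump]

theorem gaussianBump_apply_affine (A : V ≃L[ℝ] V) (ξ₀ η : V) :
    gaussianBump A ξ₀ (ξ₀ + A η) = (rexp (-π * ‖η‖ ^ 2) : ℂ) := by
  simp [gaussianBump_apply, gaussianSchwartz_apply]

variable [FiniteDimensional ℝ V] [MeasurableSpace V] [BorelSpace V]

/-- The Schwartz function with Fourier transform `(1 + |2πξ|²)^{-s/2} gaussianBump A ξ₀`. -/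
noncomputable def besselPacket (s : ℝ) (A : V ≃L[ℝ] V) (ξ₀ : V) : 𝓢(V, ℂ) :=
  SchwartzMap.fourierMultiplierCLM ℂ (fun ξ : V ↦ ((besselSymbol (-s) ξ : ℝ) : ℂ))
    (𝓕⁻ (gaussianBump A ξ₀))

theorem fourier_besselPacket (s : ℝ) (A : V ≃L[ℝ] V) (ξ₀ ξ : V) :
    (𝓕 (besselPacket s A ξ₀) : 𝓢(V, ℂ)) ξ = besselSymbol (-s) ξ * gaussianBump A ξ₀ ξ := by
  rw [besselPacket, SchwartzMap.fourierMultiplierCLM_apply,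
    FourierTransform.fourier_fourierInv_eq, FourierTransform.fourier_fourierInv_eq,
    SchwartzMap.smulLeftCLM_apply_apply (besselSymbol_hasTemperateGrowth (-s)), smul_eq_mul]

/-- Translation in frequency is a modulation, and the Gaussian is its own transform.
Self-adjointness lets `A` itself, rather than its adjoint, act on `x`. -/
theorem norm_fourierInv_gaussianBump (A : V ≃L[ℝ] V)
    (hA : ∀ x y, inner ℝ (A x) y = inner ℝ x (A y)) (ξ₀ x : V) :
    ‖(𝓕⁻ (gaussianBump A ξ₀) : 𝓢(V, ℂ)) x‖ = jac A * ‖gaussianSchwartz V (A x)‖ := by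
  have h : (𝓕⁻ (gaussianBump A ξ₀) : 𝓢(V, ℂ)) x
      = jac A * (Complex.exp ((2 * π * inner ℝ ξ₀ x : ℝ) * Complex.I) *
          (𝓕⁻ (gaussianSchwartz V) : 𝓢(V, ℂ)) (A x)) := by
    rw [SchwartzMap.fourierInv_coe, SchwartzMap.fourierInv_coe, Real.fourierInv_eq',
      Real.fourierInv_eq', integral_comp_affine A ξ₀, Complex.real_smul]
    congr 1
    rw [← integral_const_mul]
    refine integral_congr_ae (Eventually.of_forall fun η ↦ ?_)
    simp only
    rw [gaussianBump_apply_affine, gaussianSchwartz_apply, inner_add_left, hA, mul_add,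
      smul_eq_mul, smul_eq_mul, ← mul_assoc, ← Complex.exp_add]
    congr 2
    push_cast
    ring
  rw [h, fourierInv_gaussianSchwartz, norm_mul, norm_mul, Complex.norm_exp_ofReal_mul_I, one_mul,
    Complex.norm_real, Real.norm_of_nonneg (jac_pos A).le]

theorem eLpNorm_fourierInv_gaussianBump (A : V ≃L[ℝ] V)
    (hA : ∀ x y, inner ℝ (A x) y = inner ℝ x (A y)) (ξ₀ : V) {p : ℝ} (hp : 1 ≤ p) :
    eLpNorm (𝓕⁻ (gaussianBump A ξ₀) : 𝓢(V, ℂ)) (ENNReal.ofReal p) volume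
      = ENNReal.ofReal (jac A ^ (1 - 1 / p)) *
        eLpNorm (gaussianSchwartz V) (ENNReal.ofReal p) volume := by
  have h : eLpNorm (𝓕⁻ (gaussianBump A ξ₀) : 𝓢(V, ℂ)) (ENNReal.ofReal p) volume
      = eLpNorm (jac A • fun x ↦ gaussianSchwartz V (A x)) (ENNReal.ofReal p) volume := by
    refine eLpNorm_congr_norm_ae (Eventually.of_forall fun x ↦ ?_)
    rw [norm_fourierInv_gaussianBump A hA, Pi.smul_apply, norm_smul,
      Real.norm_of_nonneg (jac_pos A).le]
  rw [h, eLpNorm_const_smul, eLpNorm_comp_linear A _ hp, ← mul_assoc,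
    Real.enorm_of_nonneg (jac_pos A).le, ← ENNReal.ofReal_mul (jac_pos A).le,
    sub_eq_add_neg, rpow_add (jac_pos A), rpow_one]

end WavePacket

theorem besselOp_besselPacket {n : ℕ} (s : ℝ)
    (A : EuclideanSpace ℝ (Fin n) ≃L[ℝ] EuclideanSpace ℝ (Fin n)) (ξ₀ : EuclideanSpace ℝ (Fin n)) :
    besselOp n s (besselPacket s A ξ₀ : 𝓢'(EuclideanSpace ℝ (Fin n), ℂ))
      = ((𝓕⁻ (gaussianBump A ξ₀) : 𝓢(EuclideanSpace ℝ (Fin n), ℂ)) :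
          𝓢'(EuclideanSpace ℝ (Fin n), ℂ)) := by
  have h := besselSymbol_hasTemperateGrowth (V := EuclideanSpace ℝ (Fin n)) s
  change TemperedDistribution.fourierMultiplierCLM ℂ
    (fun ξ ↦ ((besselSymbol s ξ : ℝ) : ℂ)) _ = _
  rw [TemperedDistribution.fourierMultiplierCLM_toTemperedDistributionCLM_eq h, besselPacket,
    SchwartzMap.fourierMultiplierCLM_fourierMultiplierCLM_apply h
      (besselSymbol_hasTemperateGrowth (-s))]
  have h1 : ((fun ξ : EuclideanSpace ℝ (Fin n) ↦ ((besselSymbol s ξ : ℝ) : ℂ)) *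
      fun ξ ↦ ((besselSymbol (-s) ξ : ℝ) : ℂ)) = fun _ ↦ 1 := by
    funext ξ
    rw [Pi.mul_apply, ← Complex.ofReal_mul, besselSymbol_mul_neg, Complex.ofReal_one]
  rw [h1]
  simp

theorem isLpFunction_besselOp_besselPacket {n : ℕ} (s p : ℝ)
    (A : EuclideanSpace ℝ (Fin n) ≃L[ℝ] EuclideanSpace ℝ (Fin n))
    (ξ₀ : EuclideanSpace ℝ (Fin n)) :
    IsLpFunction (ENNReal.ofReal p)
      (besselOp n s (besselPacket s A ξ₀ : 𝓢'(EuclideanSpace ℝ (Fin n), ℂ)))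
      (𝓕⁻ (gaussianBump A ξ₀) : 𝓢(EuclideanSpace ℝ (Fin n), ℂ)) := by
  refine ⟨SchwartzMap.memLp _ _ volume, fun ψ ↦ ?_⟩
  rw [besselOp_besselPacket, SchwartzMap.coe_apply]
  simp

theorem besselNorm_besselPacket_le {n : ℕ} (s : ℝ) {p : ℝ} (hp : 1 ≤ p)
    (A : EuclideanSpace ℝ (Fin n) ≃L[ℝ] EuclideanSpace ℝ (Fin n))
    (hA : ∀ x y, inner ℝ (A x) y = inner ℝ x (A y)) (ξ₀ : EuclideanSpace ℝ (Fin n)) :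
    besselNorm s (ENNReal.ofReal p) (besselPacket s A ξ₀ : 𝓢'(EuclideanSpace ℝ (Fin n), ℂ)) ≤
      ENNReal.ofReal (jac A ^ (1 - 1 / p)) *
        eLpNorm (gaussianSchwartz (EuclideanSpace ℝ (Fin n))) (ENNReal.ofReal p) volume := by
  rw [← eLpNorm_fourierInv_gaussianBump A hA ξ₀ hp]
  exact iInf₂_le _ (isLpFunction_besselOp_besselPacket s p A ξ₀)

/-! ### Maximal function and evolution of a packet -/

theorem le_weakNormOn {n : ℕ} {q : ℝ} (hq : 0 < q) {S T : Set (EuclideanSpace ℝ (Fin n))}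
    {F : EuclideanSpace ℝ (Fin n) → ℝ≥0∞} {δ : ℝ} (hTS : T ⊆ S)
    (hT : ∀ x ∈ T, ENNReal.ofReal δ < F x) :
    ENNReal.ofReal δ * volume T ^ (1 / q) ≤ weakNormOn q S F := by
  have h : ENNReal.ofReal δ * volume {x ∈ S | ENNReal.ofReal δ < F x} ^ (1 / q)
      ≤ weakNormOn q S F :=
    le_iSup (fun δ : ℝ≥0 ↦ (δ : ℝ≥0∞) * (volume {x ∈ S | (δ : ℝ≥0∞) < F x}) ^ (1 / q)) δ.toNNReal
  refine le_trans ?_ h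
  gcongr
  exact fun x hx ↦ ⟨hTS hx, hT x hx⟩

theorem lt_schrodingerMaximal {n : ℕ} {f : EuclideanSpace ℝ (Fin n) → ℂ}
    {x : EuclideanSpace ℝ (Fin n)} {δ t : ℝ} (ht0 : 0 < t) (ht1 : t < 1)
    (hδ0 : 0 ≤ δ) (hδ : δ < ‖schrodingerEvol t f x‖) :
    ENNReal.ofReal δ < schrodingerMaximal f x := by
  refine lt_of_lt_of_le ?_
    (le_iSup₂ (f := fun t (_ : t ∈ Set.Ioo (0 : ℝ) 1) ↦ ‖schrodingerEvol t f x‖ₑ) t ⟨ht0, ht1⟩)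
  rw [← ofReal_norm]
  exact ENNReal.ofReal_lt_ofReal_iff_of_nonneg hδ0 |>.2 hδ

theorem fourierHat_two_pi_smul {n : ℕ} (f : EuclideanSpace ℝ (Fin n) → ℂ)
    (ξ : EuclideanSpace ℝ (Fin n)) : fourierHat f ((2 * π) • ξ) = 𝓕 f ξ := by
  rw [fourierHat, Real.fourier_eq']
  congr 1
  funext x
  rw [inner_smul_right, smul_eq_mul]
  congr 2
  push_cast
  ring

/-- The phase of the Schrödinger evolution, in the normalization `e^{-2πi x·ξ}` of the Fourier
transform. -/
noncomputable def schrodingerPhase {V : Type*} [NormedAddCommGroup V] [InnerProductSpace ℝ V]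
    (t : ℝ) (x ξ : V) : ℝ :=
  2 * π * inner ℝ x ξ - 4 * π ^ 2 * t * ‖ξ‖ ^ 2

/-- The substitution `ξ ↦ 2πξ` absorbs the factor `(2π)^{-n}`. -/
theorem schrodingerEvol_eq_integral_fourier {n : ℕ} (t : ℝ) (f : EuclideanSpace ℝ (Fin n) → ℂ)
    (x : EuclideanSpace ℝ (Fin n)) :
    schrodingerEvol t f x
      = ∫ ξ, Complex.exp ((schrodingerPhase t x ξ : ℝ) * Complex.I) * 𝓕 f ξ := by
  have h := Measure.integral_comp_smul (volume : Measure (EuclideanSpace ℝ (Fin n)))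
    (fun ξ ↦ Complex.exp (Complex.I * ((inner ℝ x ξ - t * ‖ξ‖ ^ 2 : ℝ) : ℂ)) * fourierHat f ξ)
    (2 * π)
  rw [finrank_euclideanSpace_fin, abs_of_pos (by positivity), Complex.real_smul] at h
  rw [schrodingerEvol, ← h]
  congr 1
  funext ξ
  rw [fourierHat_two_pi_smul, inner_smul_right, norm_smul, Real.norm_of_nonneg two_pi_pos.le,
    schrodingerPhase]
  congr 2
  push_cast
  ring

/-- The ratio of the symbol of `(1 - Δ)^{-s/2}` at `ξ₀ + ζ` to that at `ξ₀`. -/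
noncomputable def symbolRatio {V : Type*} [NormedAddCommGroup V] (s : ℝ) (ξ₀ ζ : V) : ℝ :=
  besselSymbol (-s) (ξ₀ + ζ) / besselSymbol (-s) ξ₀

theorem continuous_symbolRatio {V : Type*} [NormedAddCommGroup V] (s : ℝ) (ξ₀ : V) :
    Continuous (symbolRatio s ξ₀) := by
  unfold symbolRatio
  exact ((continuous_besselSymbol (-s)).comp (continuous_const.add continuous_id)).div_const _

/-- Rescaling to the unit Gaussian isolates the expected size of the packet; what remains differs
from a pure Gaussian integral only by `symbolRatio`, which should be close to `1`. -/
theorem schrodingerEvol_besselPacket {n : ℕ} (s t : ℝ)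
    (A : EuclideanSpace ℝ (Fin n) ≃L[ℝ] EuclideanSpace ℝ (Fin n))
    (ξ₀ x : EuclideanSpace ℝ (Fin n)) :
    schrodingerEvol t (besselPacket s A ξ₀) x
      = ((jac A * besselSymbol (-s) ξ₀ : ℝ) : ℂ) *
        ∫ η, Complex.exp ((schrodingerPhase t x (ξ₀ + A η) : ℝ) * Complex.I) *
          ((symbolRatio s ξ₀ (A η) * rexp (-π * ‖η‖ ^ 2) : ℝ) : ℂ) := by
  rw [schrodingerEvol_eq_integral_fourier, integral_comp_affine A ξ₀, Complex.real_smul,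
    Complex.ofReal_mul, mul_assoc]
  congr 1
  rw [← integral_const_mul]
  congr 1
  funext η
  rw [← SchwartzMap.fourier_coe, fourier_besselPacket, gaussianBump_apply_affine, symbolRatio]
  have := (besselSymbol_pos (-s) ξ₀).ne'
  push_cast
  have h : ((besselSymbol (-s) ξ₀ : ℝ) : ℂ) ≠ 0 := by exact_mod_cast this
  field_simp

/-! ### Freezing the Bessel symbol on a packet -/

section SymbolRatio

variable {V : Type*} [NormedAddCommGroup V]

theorem symbolRatio_eq_rpow (s : ℝ) (ξ₀ ζ : V) :
    symbolRatio s ξ₀ ζ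
      = ((1 + (2 * π * ‖ξ₀ + ζ‖) ^ 2) / (1 + (2 * π * ‖ξ₀‖) ^ 2)) ^ (-s / 2) := by
  rw [symbolRatio, besselSymbol, besselSymbol, div_rpow (by positivity) (by positivity)]

theorem symbolRatio_pos (s : ℝ) (ξ₀ ζ : V) : 0 < symbolRatio s ξ₀ ζ :=
  div_pos (besselSymbol_pos _ _) (besselSymbol_pos _ _)

/-- A Peetre-type comparison, polynomial in `r` and uniform in `a`. Only a near cancellation of `ξ₀`
and `ζ` is delicate: it needs `a r` comparable to `a^κ`, so `r` is at least of order `a^{κ-1}` and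
`‖ξ₀‖` is bounded by a power of `r`. -/
theorem japanese_quotient_le {ξ₀ ζ : V} {a r κ : ℝ} {m : ℕ} (ha : 1 ≤ a) (hκ : 1 < κ)
    (hm : κ / (κ - 1) ≤ m) (hξ₀ : ‖ξ₀‖ = a ^ κ) (hζ : ‖ζ‖ ≤ a * r) :
    1 + (2 * π * ‖ξ₀ + ζ‖) ^ 2 ≤ 100 * (2 * (1 + r)) ^ (2 * m) * (1 + (2 * π * ‖ξ₀‖) ^ 2) ∧
    1 + (2 * π * ‖ξ₀‖) ^ 2 ≤ 100 * (2 * (1 + r)) ^ (2 * m) * (1 + (2 * π * ‖ξ₀ + ζ‖) ^ 2) := by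
  have hr : 0 ≤ r := by
    by_contra h
    have := norm_nonneg ζ
    nlinarith
  have haR : a ≤ a ^ κ := by
    conv_lhs => rw [← rpow_one a]
    exact rpow_le_rpow_of_exponent_le ha hκ.le
  have hκ1 : 0 < κ - 1 := by linarith
  have hm1 : 1 ≤ m := by
    have h1 : 1 ≤ κ / (κ - 1) := by rw [le_div_iff₀ hκ1]; linarith
    exact_mod_cast h1.trans hm
  have hbase : 1 ≤ 2 * (1 + r) := by linarith
  have hpi := Real.pi_lt_four
  have hpi0 := Real.pi_pos
  have hsq : (2 * (1 + r)) ^ 2 ≤ (2 * (1 + r)) ^ (2 * m) := pow_le_pow_right₀ hbase (by omega)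
  have hL1 : 1 ≤ (2 * (1 + r)) ^ (2 * m) := one_le_pow₀ hbase
  constructor
  · have h1 : ‖ξ₀ + ζ‖ ≤ ‖ξ₀‖ * (2 * (1 + r)) := by
      have := norm_add_le ξ₀ ζ
      rw [hξ₀] at this ⊢
      nlinarith
    calc 1 + (2 * π * ‖ξ₀ + ζ‖) ^ 2 ≤ 1 + (2 * π * (‖ξ₀‖ * (2 * (1 + r)))) ^ 2 := by gcongr
      _ = 1 + (2 * (1 + r)) ^ 2 * (2 * π * ‖ξ₀‖) ^ 2 := by ring
      _ ≤ (2 * (1 + r)) ^ (2 * m) + (2 * (1 + r)) ^ (2 * m) * (2 * π * ‖ξ₀‖) ^ 2 := by gcongr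
      _ = 1 * (2 * (1 + r)) ^ (2 * m) * (1 + (2 * π * ‖ξ₀‖) ^ 2) := by ring
      _ ≤ _ := by gcongr; norm_num
  · by_cases hc : a * r ≤ ‖ξ₀‖ / 2
    · have h1 : ‖ξ₀‖ ≤ 2 * ‖ξ₀ + ζ‖ := by
        have : ‖ξ₀‖ ≤ ‖ξ₀ + ζ‖ + ‖ζ‖ := by
          simpa using norm_sub_le (ξ₀ + ζ) ζ
        linarith
      calc 1 + (2 * π * ‖ξ₀‖) ^ 2 ≤ 1 + (2 * π * (2 * ‖ξ₀ + ζ‖)) ^ 2 := by gcongr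
        _ ≤ 100 * 1 * (1 + (2 * π * ‖ξ₀ + ζ‖) ^ 2) := by
          nlinarith [sq_nonneg (2 * π * ‖ξ₀ + ζ‖)]
        _ ≤ _ := by gcongr
    · push Not at hc
      have ha0 : 0 < a := by linarith
      have h1 : a ^ (κ - 1) ≤ 2 * (1 + r) := by
        rw [rpow_sub_one ha0.ne', div_le_iff₀ ha0]
        rw [hξ₀] at hc
        nlinarith
      have h2 : ‖ξ₀‖ ≤ (2 * (1 + r)) ^ m := by
        calc ‖ξ₀‖ = (a ^ (κ - 1)) ^ (κ / (κ - 1)) := by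
              rw [hξ₀, ← rpow_mul ha0.le, mul_div_cancel₀ _ hκ1.ne']
          _ ≤ (a ^ (κ - 1)) ^ (m : ℝ) :=
              rpow_le_rpow_of_exponent_le (one_le_rpow ha hκ1.le) hm
          _ = (a ^ (κ - 1)) ^ m := rpow_natCast _ _
          _ ≤ _ := by gcongr
      calc 1 + (2 * π * ‖ξ₀‖) ^ 2 ≤ (2 * (1 + r)) ^ (2 * m) + (2 * 4 * (2 * (1 + r)) ^ m) ^ 2 := by
            gcongr
        _ = 65 * (2 * (1 + r)) ^ (2 * m) * 1 := by rw [mul_pow (2 * 4), ← pow_mul, mul_comm m 2]; ring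
        _ ≤ _ := by
          gcongr
          · norm_num
          · nlinarith [sq_nonneg (2 * π * ‖ξ₀ + ζ‖)]

/-- Supplies the dominating function: polynomial growth, with constants independent of `a`, is
integrable against the Gaussian. -/
theorem exists_abs_symbolRatio_sub_one_le (s : ℝ) {κ : ℝ} (hκ : 1 < κ) :
    ∃ (C : ℝ) (M : ℕ), ∀ (ξ₀ ζ : V) (a r : ℝ), 1 ≤ a → ‖ξ₀‖ = a ^ κ → ‖ζ‖ ≤ a * r →
      |symbolRatio s ξ₀ ζ - 1| ≤ C * (1 + r) ^ M := by
  obtain ⟨m, hm⟩ := exists_nat_ge (κ / (κ - 1))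
  obtain ⟨N, hN⟩ := exists_nat_ge (|s| / 2)
  refine ⟨(100 * 2 ^ (2 * m)) ^ N, 2 * m * N, fun ξ₀ ζ a r ha hξ₀ hζ ↦ ?_⟩
  obtain ⟨h1, h2⟩ := japanese_quotient_le ha hκ hm hξ₀ hζ
  have hr : 0 ≤ r := by
    by_contra h
    have := norm_nonneg ζ
    nlinarith
  have hrhs : (100 * 2 ^ (2 * m) : ℝ) ^ N * (1 + r) ^ (2 * m * N)
      = (100 * (2 * (1 + r)) ^ (2 * m)) ^ N := by
    rw [pow_mul (1 + r), mul_pow 2 (1 + r), ← mul_pow, mul_assoc]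
  have hL : 1 ≤ 100 * (2 * (1 + r)) ^ (2 * m) := by
    have : 1 ≤ (2 * (1 + r)) ^ (2 * m) := one_le_pow₀ (by linarith)
    linarith
  set L := 100 * (2 * (1 + r)) ^ (2 * m)
  set x := 1 + (2 * π * ‖ξ₀ + ζ‖) ^ 2
  set y := 1 + (2 * π * ‖ξ₀‖) ^ 2
  have hx : 0 < x := by positivity
  have hy : 0 < y := by positivity
  have hle : symbolRatio s ξ₀ ζ ≤ L ^ N := by
    have h3 : symbolRatio s ξ₀ ζ ≤ L ^ (|s| / 2) := by
      rw [symbolRatio_eq_rpow]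
      rcases le_total 0 s with hs | hs
      · rw [abs_of_nonneg hs, neg_div, rpow_neg (by positivity), ← inv_rpow (by positivity),
          inv_div]
        exact rpow_le_rpow (by positivity) ((div_le_iff₀ hx).2 h2) (by positivity)
      · rw [abs_of_nonpos hs]
        exact rpow_le_rpow (by positivity) ((div_le_iff₀ hy).2 h1) (by linarith)
    refine h3.trans ?_
    rw [← rpow_natCast]
    exact rpow_le_rpow_of_exponent_le hL hN
  rw [hrhs, abs_le]
  have := symbolRatio_pos s ξ₀ ζ
  have hLN : 1 ≤ L ^ N := one_le_pow₀ hL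
  constructor <;> linarith

/-- The relative displacement `‖ζ‖ / ‖ξ₀‖` is at most `r a^{1-κ}`, which tends to zero. -/
theorem tendsto_symbolRatio (s : ℝ) {κ r : ℝ} (hκ : 1 < κ) (ξ₀ ζ : ℝ → V)
    (hξ₀ : ∀ a, 1 ≤ a → ‖ξ₀ a‖ = a ^ κ) (hζ : ∀ a, 1 ≤ a → ‖ζ a‖ ≤ a * r) :
    Tendsto (fun a ↦ symbolRatio s (ξ₀ a) (ζ a)) atTop (𝓝 1) := by
  have hinv : Tendsto (fun a : ℝ ↦ (a ^ κ)⁻¹ ^ 2) atTop (𝓝 0) := by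
    simpa using (tendsto_rpow_atTop (by linarith : 0 < κ)).inv_tendsto_atTop.pow 2
  have hρ : Tendsto (fun a : ℝ ↦ ‖ξ₀ a + ζ a‖ / a ^ κ) atTop (𝓝 1) := by
    rw [tendsto_iff_dist_tendsto_zero]
    have h0 : Tendsto (fun a : ℝ ↦ r * a ^ (-(κ - 1))) atTop (𝓝 0) := by
      simpa using (tendsto_rpow_neg_atTop (by linarith : 0 < κ - 1)).const_mul r
    refine squeeze_zero' (Eventually.of_forall fun a ↦ dist_nonneg) ?_ h0
    filter_upwards [eventually_ge_atTop 1] with a ha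
    have ha0 : 0 < a := by linarith
    have hR : 0 < a ^ κ := rpow_pos_of_pos ha0 κ
    rw [Real.dist_eq, div_sub_one hR.ne', abs_div, abs_of_pos hR, div_le_iff₀ hR, mul_assoc,
      ← rpow_add ha0, ← hξ₀ a ha]
    have h1 := abs_norm_sub_norm_le (ξ₀ a + ζ a) (ξ₀ a)
    rw [add_sub_cancel_left] at h1
    refine h1.trans ((hζ a ha).trans (le_of_eq ?_))
    ring_nf
    rw [rpow_one, mul_comm]
  have hq : Tendsto (fun a : ℝ ↦ ((a ^ κ)⁻¹ ^ 2 + (2 * π * (‖ξ₀ a + ζ a‖ / a ^ κ)) ^ 2) /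
      ((a ^ κ)⁻¹ ^ 2 + (2 * π) ^ 2)) atTop (𝓝 1) := by
    have h1 := (hinv.add ((hρ.const_mul (2 * π)).pow 2)).div (hinv.add_const ((2 * π) ^ 2))
      (by positivity)
    rwa [zero_add, zero_add, mul_one, div_self (by positivity)] at h1
  have hf := hq.rpow_const (p := -s / 2) (Or.inl one_ne_zero)
  rw [one_rpow] at hf
  refine hf.congr' ?_
  filter_upwards [eventually_ge_atTop 1] with a ha
  have hR : 0 < a ^ κ := rpow_pos_of_pos (by linarith) κ
  rw [symbolRatio_eq_rpow, hξ₀ a ha]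
  congr 1
  field_simp

theorem abs_pow_mul_gaussian_le {C x : ℝ} {M : ℕ} (k : ℕ) (v : V)
    (h : |x| ≤ C * (1 + ‖v‖) ^ M) :
    ‖|x| ^ k * rexp (-π * ‖v‖ ^ 2)‖ ≤ C ^ k * (1 + ‖v‖) ^ (M * k) * rexp (-π * ‖v‖ ^ 2) := by
  rw [Real.norm_of_nonneg (by positivity), pow_mul, ← mul_pow]
  gcongr

end SymbolRatio

/-! ### Vanishing of the symbol error -/

section DominatedConvergence

variable {V : Type*} [NormedAddCommGroup V] [InnerProductSpace ℝ V] [FiniteDimensional ℝ V]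
  [MeasurableSpace V] [BorelSpace V]

theorem integrable_one_add_pow_mul_gaussian (C : ℝ) (m : ℕ) :
    Integrable (fun v : V ↦ C * (1 + ‖v‖) ^ m * rexp (-π * ‖v‖ ^ 2)) := by
  have h := (((integrable_gaussian (V := V)).add (integrable_pow_mul_gaussian (V := V) m)).const_mul
    (2 ^ (m - 1))).const_mul |C|
  refine h.mono' (by fun_prop) (Eventually.of_forall fun v ↦ ?_)
  rw [norm_mul, norm_mul, Real.norm_eq_abs, norm_pow, Real.norm_of_nonneg (by positivity),
    Real.norm_of_nonneg (by positivity), mul_assoc]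
  have h1 := add_pow_le zero_le_one (norm_nonneg v) m
  rw [one_pow] at h1
  refine mul_le_mul_of_nonneg_left ?_ (abs_nonneg C)
  calc _ ≤ 2 ^ (m - 1) * (1 + ‖v‖ ^ m) * rexp (-π * ‖v‖ ^ 2) := by gcongr
    _ = _ := by rw [Pi.add_apply]; ring

theorem integrable_symbolRatio_sub_one_pow (s : ℝ) {κ a : ℝ} (hκ : 1 < κ) (ha : 1 ≤ a) {ξ₀ : V}
    (hξ₀ : ‖ξ₀‖ = a ^ κ) {A : V → V} (hAc : Continuous A) (hA : ∀ η, ‖A η‖ ≤ a * ‖η‖) (k : ℕ) :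
    Integrable (fun η : V ↦ |symbolRatio s ξ₀ (A η) - 1| ^ k * rexp (-π * ‖η‖ ^ 2)) := by
  obtain ⟨C, M, h⟩ := exists_abs_symbolRatio_sub_one_le (V := V) s hκ
  refine (integrable_one_add_pow_mul_gaussian (C ^ k) (M * k)).mono' ?_
    (Eventually.of_forall fun η ↦ abs_pow_mul_gaussian_le k η (h _ _ _ _ ha hξ₀ (hA η)))
  have := (continuous_symbolRatio s ξ₀).comp hAc
  exact Continuous.aestronglyMeasurable
    ((((this.sub continuous_const).abs).pow k).mul (by fun_prop))

/-- Dominated convergence. The exponent `k = 1` serves the pointwise error of the travelling packet,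
`k = 2` the `L²` error of the spreading one. -/
theorem tendsto_integral_symbolRatio_sub_one_pow (s : ℝ) {κ : ℝ} (hκ : 1 < κ) (ξ₀ : ℝ → V)
    (hξ₀ : ∀ a, 1 ≤ a → ‖ξ₀ a‖ = a ^ κ) (A : ℝ → V → V) (hAc : ∀ a, 1 ≤ a → Continuous (A a))
    (hA : ∀ a, 1 ≤ a → ∀ η, ‖A a η‖ ≤ a * ‖η‖) {k : ℕ} (hk : k ≠ 0) :
    Tendsto (fun a ↦ ∫ η, |symbolRatio s (ξ₀ a) (A a η) - 1| ^ k * rexp (-π * ‖η‖ ^ 2))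
      atTop (𝓝 0) := by
  obtain ⟨C, M, h⟩ := exists_abs_symbolRatio_sub_one_le (V := V) s hκ
  rw [← integral_zero V ℝ]
  refine tendsto_integral_filter_of_dominated_convergence _ ?_ ?_
    (integrable_one_add_pow_mul_gaussian (C ^ k) (M * k)) (Eventually.of_forall fun η ↦ ?_)
  · filter_upwards [eventually_ge_atTop 1] with a ha
    exact (integrable_symbolRatio_sub_one_pow s hκ ha (hξ₀ a ha) (hAc a ha) (hA a ha) k).1
  · filter_upwards [eventually_ge_atTop 1] with a ha
    exact Eventually.of_forall fun η ↦
      abs_pow_mul_gaussian_le k η (h _ _ _ _ ha (hξ₀ a ha) (hA a ha η))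
  · have h1 := tendsto_symbolRatio s hκ ξ₀ (fun a ↦ A a η) hξ₀ (fun a ha ↦ hA a ha η)
    have h2 := ((((h1.sub_const 1).abs).pow k).mul_const (rexp (-π * ‖η‖ ^ 2)))
    simpa [hk] using h2

end DominatedConvergence

theorem exists_le_besselSymbol {V : Type*} [NormedAddCommGroup V] (s : ℝ) :
    ∃ c : ℝ, 0 < c ∧ ∀ ξ : V, 1 ≤ ‖ξ‖ → c * ‖ξ‖ ^ s ≤ besselSymbol s ξ := by
  refine ⟨100 ^ (-|s|), by positivity, fun ξ hξ ↦ ?_⟩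
  have hpi := Real.pi_lt_four
  have hpi3 := Real.pi_gt_three
  have h0 : 0 < ‖ξ‖ := by linarith
  have hs : ‖ξ‖ ^ s = (‖ξ‖ ^ 2) ^ (s / 2) := by
    rw [← rpow_natCast, ← rpow_mul h0.le]; congr 1; push_cast; ring
  rw [besselSymbol, hs]
  rcases le_total 0 s with h | h
  · have h1 : ‖ξ‖ ^ 2 ≤ 1 + (2 * π * ‖ξ‖) ^ 2 := by
      nlinarith [mul_le_mul_of_nonneg_right (by linarith : 1 ≤ 2 * π) h0.le]
    have h2 : (100 : ℝ) ^ (-|s|) ≤ 1 :=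
      rpow_le_one_of_one_le_of_nonpos (by norm_num) (by simp)
    calc _ ≤ 1 * (‖ξ‖ ^ 2) ^ (s / 2) := by gcongr
      _ ≤ _ := by rw [one_mul]; gcongr
  · have h1 : 1 + (2 * π * ‖ξ‖) ^ 2 ≤ 100 ^ 2 * ‖ξ‖ ^ 2 := by
      calc 1 + (2 * π * ‖ξ‖) ^ 2 ≤ ‖ξ‖ ^ 2 + (2 * 4 * ‖ξ‖) ^ 2 := by
            gcongr
            exact one_le_pow₀ hξ
        _ ≤ _ := by nlinarith [sq_nonneg ‖ξ‖]
    have h2 : (100 : ℝ) ^ (-|s|) = (100 ^ 2) ^ (s / 2) := by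
      rw [← rpow_natCast, ← rpow_mul (by norm_num), abs_of_nonpos h]; congr 1; push_cast; ring
    rw [h2, ← mul_rpow (by positivity) (by positivity)]
    exact rpow_le_rpow_of_nonpos (by positivity) h1 (by linarith)

/-! ### Anisotropic dilations -/

section Stretch

variable {V : Type*} [NormedAddCommGroup V] [InnerProductSpace ℝ V]

/-- The linear map that multiplies by `α` along the unit vector `e`, and by `β` on its orthogonal
complement. -/
noncomputable def stretchMap (e : V) (α β : ℝ) : V →L[ℝ] V :=
  β • ContinuousLinearMap.id ℝ V + (α - β) • (innerSL ℝ e).smulRight e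

theorem stretchMap_apply (e : V) (α β : ℝ) (x : V) :
    stretchMap e α β x = β • x + ((α - β) * inner ℝ e x) • e := by
  simp [stretchMap, smul_smul]

theorem stretchMap_comp {e : V} (he : ‖e‖ = 1) {α β : ℝ} (hα : α ≠ 0) (hβ : β ≠ 0) (x : V) :
    stretchMap e α⁻¹ β⁻¹ (stretchMap e α β x) = x := by
  have hee : inner ℝ e e = (1 : ℝ) := by rw [real_inner_self_eq_norm_sq, he, one_pow]
  rw [stretchMap_apply, stretchMap_apply, inner_add_right, inner_smul_right, inner_smul_right, hee,
    smul_add, smul_smul, smul_smul, inv_mul_cancel₀ hβ, one_smul, add_assoc, ← add_smul]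
  have : β⁻¹ * ((α - β) * inner ℝ e x) +
      (α⁻¹ - β⁻¹) * (β * inner ℝ e x + (α - β) * inner ℝ e x * 1) = 0 := by
    field_simp
    ring
  rw [this, zero_smul, add_zero]

/-- `stretchMap` as an isomorphism. -/
noncomputable def stretch {e : V} (he : ‖e‖ = 1) {α β : ℝ} (hα : α ≠ 0) (hβ : β ≠ 0) : V ≃L[ℝ] V :=
  ContinuousLinearEquiv.equivOfInverse (stretchMap e α β) (stretchMap e α⁻¹ β⁻¹)
    (stretchMap_comp he hα hβ)
    (fun x ↦ by
      have := stretchMap_comp he (inv_ne_zero hα) (inv_ne_zero hβ) x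
      rwa [inv_inv, inv_inv] at this)

theorem stretch_apply {e : V} (he : ‖e‖ = 1) {α β : ℝ} (hα : α ≠ 0) (hβ : β ≠ 0) (x : V) :
    stretch he hα hβ x = β • x + ((α - β) * inner ℝ e x) • e :=
  stretchMap_apply e α β x

theorem stretch_symm {e : V} (he : ‖e‖ = 1) {α β : ℝ} (hα : α ≠ 0) (hβ : β ≠ 0) (x y : V) :
    inner ℝ (stretch he hα hβ x) y = inner ℝ x (stretch he hα hβ y) := by
  rw [stretch_apply, stretch_apply, inner_add_left, inner_add_right, inner_smul_left,
    inner_smul_right, inner_smul_left, inner_smul_right, real_inner_comm x e]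
  simp
  ring

theorem norm_sq_stretch {e : V} (he : ‖e‖ = 1) {α β : ℝ} (hα : α ≠ 0) (hβ : β ≠ 0) (x : V) :
    ‖stretch he hα hβ x‖ ^ 2 = β ^ 2 * ‖x‖ ^ 2 + (α ^ 2 - β ^ 2) * inner ℝ e x ^ 2 := by
  rw [stretch_apply, norm_add_sq_real, inner_smul_left, inner_smul_right, norm_smul, norm_smul, he,
    mul_pow, mul_pow, Real.norm_eq_abs, Real.norm_eq_abs, sq_abs, sq_abs, real_inner_comm x e]
  simp
  ring

theorem norm_stretch_le {e : V} (he : ‖e‖ = 1) {α β : ℝ} (hα : α ≠ 0) (hβ : β ≠ 0) (hβ0 : 0 ≤ β)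
    (h : β ≤ α) (x : V) : ‖stretch he hα hβ x‖ ≤ α * ‖x‖ := by
  have h1 : inner ℝ e x ^ 2 ≤ ‖x‖ ^ 2 := by
    have := abs_real_inner_le_norm e x
    rw [he, one_mul] at this
    exact sq_le_sq' (by linarith [abs_le.1 this]) (abs_le.1 this).2
  refine le_of_sq_le_sq ?_ (mul_nonneg (hβ0.trans h) (norm_nonneg x))
  rw [norm_sq_stretch, mul_pow]
  nlinarith [mul_self_le_mul_self hβ0 h]

/-- The map is `β` times a transvection, and the transvection has determinant `1 + (α/β - 1) = α/β`.
-/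
theorem jac_stretch [FiniteDimensional ℝ V] {e : V} (he : ‖e‖ = 1) {α β : ℝ} (hα : α ≠ 0)
    (hβ : β ≠ 0) :
    jac (stretch he hα hβ) = |β ^ Module.finrank ℝ V * (α / β)| := by
  have h : (stretch he hα hβ : V →ₗ[ℝ] V)
      = β • LinearMap.transvection ((α / β - 1) • (innerSL ℝ e : V →ₗ[ℝ] ℝ)) e := by
    ext x
    have : (stretch he hα hβ : V →ₗ[ℝ] V) x = stretch he hα hβ x := rfl
    rw [this, stretch_apply, LinearMap.smul_apply, LinearMap.transvection.apply, smul_add,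
      smul_smul]
    congr 2
    simp
    field_simp
  rw [jac, h, LinearMap.det_smul, LinearMap.transvection.det]
  congr 2
  simp [he]

end Stretch

/-! ### Integrals with nearly constant phase -/

section PhaseLowerBound

variable {V : Type*} [NormedAddCommGroup V] [InnerProductSpace ℝ V] [FiniteDimensional ℝ V]
  [MeasurableSpace V] [BorelSpace V]

theorem norm_exp_ofReal_mul_I_sub_le (x y : ℝ) :
    ‖Complex.exp (x * Complex.I) - Complex.exp (y * Complex.I)‖ ≤ |x - y| := by
  have h : Complex.exp (x * Complex.I) - Complex.exp (y * Complex.I)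
      = Complex.exp (y * Complex.I) * (Complex.exp (Complex.I * ((x - y : ℝ) : ℂ)) - 1) := by
    rw [mul_sub, ← Complex.exp_add, mul_one]
    congr 2
    push_cast
    ring
  rw [h, norm_mul, Complex.norm_exp_ofReal_mul_I, one_mul]
  exact Real.norm_exp_I_mul_ofReal_sub_one_le

/-- With phase frozen at `θ₀` and weight at `1`, the integral has modulus `1`, the mass of the
Gaussian; the two subtracted terms are the costs of freezing. -/
theorem le_norm_integral_exp_mul_gaussian {θ w : V → ℝ} (hθ : Continuous θ) (hw : Continuous w)
    (hwi : Integrable fun η : V ↦ |w η - 1| * rexp (-π * ‖η‖ ^ 2)) {θ₀ δ : ℝ}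
    (hθ₀ : ∀ η, |θ η - θ₀| ≤ δ * (‖η‖ + ‖η‖ ^ 2)) :
    1 - δ * (∫ η : V, (‖η‖ + ‖η‖ ^ 2) * rexp (-π * ‖η‖ ^ 2))
        - ∫ η : V, |w η - 1| * rexp (-π * ‖η‖ ^ 2) ≤
      ‖∫ η : V, Complex.exp ((θ η : ℝ) * Complex.I) * ((w η * rexp (-π * ‖η‖ ^ 2) : ℝ) : ℂ)‖ := by
  have hg := integrable_gaussian (V := V)
  have hgi : Integrable (fun η : V ↦ (‖η‖ + ‖η‖ ^ 2) * rexp (-π * ‖η‖ ^ 2)) := by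
    refine ((integrable_pow_mul_gaussian (V := V) 1).add
      (integrable_pow_mul_gaussian (V := V) 2)).congr (Eventually.of_forall fun η ↦ ?_)
    simp only [Pi.add_apply]
    ring
  have hconst : ∫ η : V, Complex.exp (θ₀ * Complex.I) * ((rexp (-π * ‖η‖ ^ 2) : ℝ) : ℂ)
      = Complex.exp (θ₀ * Complex.I) := by
    rw [integral_const_mul, integral_complex_ofReal, integral_gaussian_eq_one]
    simp
  have hwg : Integrable (fun η : V ↦ w η * rexp (-π * ‖η‖ ^ 2)) := by
    refine (hwi.add hg).mono' (by fun_prop) (Eventually.of_forall fun η ↦ ?_)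
    rw [norm_mul, Real.norm_of_nonneg (exp_pos _).le, Real.norm_eq_abs, Pi.add_apply,
      ← add_one_mul]
    gcongr
    calc |w η| = |(w η - 1) + 1| := by ring_nf
      _ ≤ _ := (abs_add_le _ _).trans (by simp)
  have hi1 : Integrable (fun η : V ↦
      Complex.exp ((θ η : ℝ) * Complex.I) * ((w η * rexp (-π * ‖η‖ ^ 2) : ℝ) : ℂ)) := by
    refine hwg.norm.mono' (Continuous.aestronglyMeasurable ?_) (Eventually.of_forall fun η ↦ ?_)
    · exact ((Complex.continuous_ofReal.comp hθ).mul continuous_const).cexp.mul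
        (Complex.continuous_ofReal.comp (by fun_prop))
    · rw [norm_mul, Complex.norm_exp_ofReal_mul_I, one_mul, Complex.norm_real]
  have hi2 : Integrable (fun η : V ↦
      Complex.exp (θ₀ * Complex.I) * ((rexp (-π * ‖η‖ ^ 2) : ℝ) : ℂ)) :=
    hg.ofReal.const_mul _
  have hdiff : ‖(∫ η : V, Complex.exp ((θ η : ℝ) * Complex.I) *
        ((w η * rexp (-π * ‖η‖ ^ 2) : ℝ) : ℂ)) - Complex.exp (θ₀ * Complex.I)‖
      ≤ (∫ η : V, |w η - 1| * rexp (-π * ‖η‖ ^ 2))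
        + δ * (∫ η : V, (‖η‖ + ‖η‖ ^ 2) * rexp (-π * ‖η‖ ^ 2)) := by
    conv_lhs => rw [← hconst]
    rw [← integral_sub hi1 hi2, ← integral_const_mul, ← integral_add hwi (hgi.const_mul δ)]
    refine norm_integral_le_of_norm_le (hwi.add (hgi.const_mul δ)) (Eventually.of_forall fun η ↦ ?_)
    have h1 : Complex.exp ((θ η : ℝ) * Complex.I) * ((w η * rexp (-π * ‖η‖ ^ 2) : ℝ) : ℂ)
        - Complex.exp (θ₀ * Complex.I) * ((rexp (-π * ‖η‖ ^ 2) : ℝ) : ℂ)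
        = (Complex.exp ((θ η : ℝ) * Complex.I) * ((w η - 1 : ℝ) : ℂ)
          + (Complex.exp ((θ η : ℝ) * Complex.I) - Complex.exp (θ₀ * Complex.I)))
          * ((rexp (-π * ‖η‖ ^ 2) : ℝ) : ℂ) := by
      push_cast
      ring
    rw [h1, norm_mul, Complex.norm_real, Real.norm_of_nonneg (exp_pos _).le, ← mul_assoc,
      ← add_mul]
    gcongr
    refine (norm_add_le _ _).trans (add_le_add ?_ ?_)
    · rw [norm_mul, Complex.norm_exp_ofReal_mul_I, one_mul, Complex.norm_real, Real.norm_eq_abs]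
    · exact (norm_exp_ofReal_mul_I_sub_le _ _).trans (hθ₀ η)
  have h2 := norm_sub_norm_le (Complex.exp (θ₀ * Complex.I))
    (∫ η : V, Complex.exp ((θ η : ℝ) * Complex.I) * ((w η * rexp (-π * ‖η‖ ^ 2) : ℝ) : ℂ))
  rw [norm_sub_rev, Complex.norm_exp_ofReal_mul_I] at h2
  linarith

end PhaseLowerBound

/-! ### The necessary condition from one packet -/

/-- The oscillatory integral that gives the evolution of `besselPacket s A ξ₀`, up to a factor. -/
noncomputable def packetIntegral {V : Type*} [NormedAddCommGroup V] [InnerProductSpace ℝ V]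
    [MeasureSpace V] (s t : ℝ) (A : V ≃L[ℝ] V) (ξ₀ x : V) : ℂ :=
  ∫ η, Complex.exp ((schrodingerPhase t x (ξ₀ + A η) : ℝ) * Complex.I) *
    ((symbolRatio s ξ₀ (A η) * rexp (-π * ‖η‖ ^ 2) : ℝ) : ℂ)

/-- The weak-type maximal estimate for Schwartz functions. -/
def WeakMaximalEstimate (n : ℕ) (p q s : ℝ) : Prop :=
  ∃ C : ℝ≥0, ∀ f : 𝓢(EuclideanSpace ℝ (Fin n), ℂ),
    MemBesselSpace s (ENNReal.ofReal p) (f : 𝓢'(EuclideanSpace ℝ (Fin n), ℂ)) →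
    weakNormOn q (Metric.ball (0 : EuclideanSpace ℝ (Fin n)) 1) (schrodingerMaximal f) ≤
      C * besselNorm s (ENNReal.ofReal p) (f : 𝓢'(EuclideanSpace ℝ (Fin n), ℂ))

theorem le_of_ofReal_mul_rpow_le {D M δ μ p q : ℝ} {C : ℝ≥0} {G : ℝ≥0∞} (hD : 0 < D) (hM : 0 < M)
    (hδ : 0 ≤ δ) (hμ : 0 ≤ μ) (hq : 1 ≤ q) (hG : G ≠ ⊤)
    (h : ENNReal.ofReal (D * M * δ) * ENNReal.ofReal μ ^ (1 / q)
      ≤ C * (ENNReal.ofReal (D ^ (1 - 1 / p)) * G)) :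
    δ * μ ^ (1 / q) * D ^ (1 / p) * M ≤ C * G.toReal := by
  rw [ENNReal.ofReal_rpow_of_nonneg hμ (by positivity), ← ENNReal.ofReal_mul (by positivity),
    ← ENNReal.ofReal_toReal hG, ← ENNReal.ofReal_coe_nnreal, ← ENNReal.ofReal_mul (by positivity),
    ← ENNReal.ofReal_mul (by positivity), ENNReal.ofReal_le_ofReal_iff (by positivity)] at h
  have h6 : D = D ^ (1 - 1 / p) * D ^ (1 / p) := by
    rw [← rpow_add hD, sub_add_cancel, rpow_one]
  refine le_of_mul_le_mul_left ?_ (rpow_pos_of_pos hD (1 - 1 / p))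
  calc _ = (D ^ (1 - 1 / p) * D ^ (1 / p)) * M * δ * μ ^ (1 / q) := by ring
    _ = D * M * δ * μ ^ (1 / q) := by rw [← h6]
    _ ≤ _ := h
    _ = _ := by ring

/-- The packet has height `jac A · besselSymbol (-s) ξ₀ · δ` on `T` and norm comparable to `(jac
A)^{1-1/p}`; dividing leaves the power `1/p` of the Jacobian. -/
theorem WeakMaximalEstimate.exists_bound {n : ℕ} {p q s : ℝ} (hp : 1 ≤ p) (hq : 1 ≤ q)
    (h : WeakMaximalEstimate n p q s) :
    ∃ K : ℝ, ∀ (A : EuclideanSpace ℝ (Fin n) ≃L[ℝ] EuclideanSpace ℝ (Fin n))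
      (_ : ∀ x y, inner ℝ (A x) y = inner ℝ x (A y)) (ξ₀ : EuclideanSpace ℝ (Fin n)) (δ μ : ℝ)
      (T : Set (EuclideanSpace ℝ (Fin n))), 0 ≤ δ → 0 ≤ μ → T ⊆ Metric.ball 0 1 →
      ENNReal.ofReal μ ≤ volume T →
      (∀ x ∈ T, ∃ t, 0 < t ∧ t < 1 ∧ δ < ‖packetIntegral s t A ξ₀ x‖) →
      δ * μ ^ (1 / q) * jac A ^ (1 / p) * besselSymbol (-s) ξ₀ ≤ K := by
  obtain ⟨C, hC⟩ := h
  refine ⟨C * (eLpNorm (gaussianSchwartz (EuclideanSpace ℝ (Fin n)))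
    (ENNReal.ofReal p) volume).toReal, fun A hA ξ₀ δ μ T hδ hμ hT hμT hx ↦ ?_⟩
  have hD := jac_pos A
  have hM := besselSymbol_pos (-s) ξ₀
  refine le_of_ofReal_mul_rpow_le hD hM hδ hμ hq
    ((gaussianSchwartz (EuclideanSpace ℝ (Fin n))).eLpNorm_lt_top (ENNReal.ofReal p) volume).ne ?_
  have h1 := hC (besselPacket s A ξ₀) ⟨_, isLpFunction_besselOp_besselPacket s p A ξ₀⟩
  have h2 := besselNorm_besselPacket_le s hp A hA ξ₀
  have h3 : ∀ x ∈ T, ENNReal.ofReal (jac A * besselSymbol (-s) ξ₀ * δ)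
      < schrodingerMaximal (besselPacket s A ξ₀) x := by
    intro x hxT
    obtain ⟨t, ht0, ht1, ht⟩ := hx x hxT
    refine lt_schrodingerMaximal ht0 ht1 (by positivity) ?_
    rw [schrodingerEvol_besselPacket, norm_mul, Complex.norm_real,
      Real.norm_of_nonneg (by positivity)]
    exact mul_lt_mul_of_pos_left ht (by positivity)
  have h4 := le_weakNormOn (q := q) (by linarith) hT h3
  have h5 : ENNReal.ofReal (jac A * besselSymbol (-s) ξ₀ * δ) * ENNReal.ofReal μ ^ (1 / q) ≤
      ENNReal.ofReal (jac A * besselSymbol (-s) ξ₀ * δ) * volume T ^ (1 / q) :=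
    mul_le_mul_right (ENNReal.rpow_le_rpow hμT (by positivity)) _
  exact h5.trans (h4.trans (h1.trans (mul_le_mul_right h2 _)))

/-! ### The travelling packet -/

theorem not_eventually_mul_rpow_le {c γ K : ℝ} (hc : 0 < c) (hγ : 0 < γ) :
    ¬ ∀ᶠ a : ℝ in atTop, c * a ^ γ ≤ K := by
  intro h
  have h1 := ((tendsto_rpow_atTop hγ).const_mul_atTop hc).eventually_gt_atTop K
  obtain ⟨a, h2, h3⟩ := (h.and h1).exists
  linarith

/-- The time is chosen so that the derivative of the phase along `e` vanishes at `a² e`. Only the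
transverse linear part of `x` survives, and the quadratic term stays bounded because the time is of
order `a⁻²` while the bandwidth is `a`. -/
theorem abs_schrodingerPhase_stretch_sub_le {V : Type*} [NormedAddCommGroup V]
    [InnerProductSpace ℝ V] {e : V} (he : ‖e‖ = 1) {a : ℝ} (ha0 : a ≠ 0) (ha : 1 ≤ a) (x η : V)
    (hx : 0 ≤ inner ℝ e x) :
    |schrodingerPhase (inner ℝ e x / (4 * π * a ^ 2)) x
        (a ^ 2 • e + stretch he ha0 one_ne_zero η)
      - (2 * π * a ^ 2 * inner ℝ e x - 4 * π ^ 2 * (inner ℝ e x / (4 * π * a ^ 2)) * a ^ 4)|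
      ≤ 4 * π * ‖x‖ * (‖η‖ + ‖η‖ ^ 2) := by
  have hpi := pi_pos
  have hee : inner ℝ e e = (1 : ℝ) := by rw [real_inner_self_eq_norm_sq, he, one_pow]
  have hy : inner ℝ e x ≤ ‖x‖ := by simpa [he] using real_inner_le_norm e x
  have hz : |inner ℝ e η| ≤ ‖η‖ := by simpa [he] using abs_real_inner_le_norm e η
  have hxη := abs_real_inner_le_norm x η
  have h1 : schrodingerPhase (inner ℝ e x / (4 * π * a ^ 2)) x
        (a ^ 2 • e + stretch he ha0 one_ne_zero η)
      - (2 * π * a ^ 2 * inner ℝ e x - 4 * π ^ 2 * (inner ℝ e x / (4 * π * a ^ 2)) * a ^ 4)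
      = 2 * π * (inner ℝ x η - inner ℝ e x * inner ℝ e η)
        - π * inner ℝ e x * ((‖η‖ ^ 2 + (a ^ 2 - 1) * inner ℝ e η ^ 2) / a ^ 2) := by
    rw [schrodingerPhase, norm_add_sq_real, norm_sq_stretch, stretch_apply, norm_smul, he,
      Real.norm_eq_abs, abs_of_nonneg (sq_nonneg a)]
    simp only [inner_add_right, inner_smul_right, inner_smul_left, hee, real_inner_comm e x]
    simp
    field_simp
    ring
  set y := inner ℝ e x
  set z := inner ℝ e η
  have hz2 : z ^ 2 ≤ ‖η‖ ^ 2 := sq_le_sq' (by linarith [abs_le.1 hz]) (abs_le.1 hz).2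
  have ha2 : 1 ≤ a ^ 2 := one_le_pow₀ ha
  have hq0 : 0 ≤ (‖η‖ ^ 2 + (a ^ 2 - 1) * z ^ 2) / a ^ 2 := by
    have : 0 ≤ a ^ 2 - 1 := by linarith
    positivity
  have hq : (‖η‖ ^ 2 + (a ^ 2 - 1) * z ^ 2) / a ^ 2 ≤ ‖η‖ ^ 2 := by
    rw [div_le_iff₀ (by positivity)]
    nlinarith
  have hyz : |y * z| ≤ ‖x‖ * ‖η‖ := by
    rw [abs_mul, abs_of_nonneg hx]
    gcongr
  have hyq : y * ((‖η‖ ^ 2 + (a ^ 2 - 1) * z ^ 2) / a ^ 2) ≤ ‖x‖ * ‖η‖ ^ 2 := by gcongr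
  rw [h1]
  calc _ ≤ |2 * π * (inner ℝ x η - y * z)|
        + |π * y * ((‖η‖ ^ 2 + (a ^ 2 - 1) * z ^ 2) / a ^ 2)| := abs_sub _ _
    _ = 2 * π * |inner ℝ x η - y * z| + π * (y * ((‖η‖ ^ 2 + (a ^ 2 - 1) * z ^ 2) / a ^ 2)) := by
        rw [abs_mul, abs_of_pos two_pi_pos, abs_of_nonneg (a := π * y * _) (by positivity),
          mul_assoc π y]
    _ ≤ 2 * π * (‖x‖ * ‖η‖ + ‖x‖ * ‖η‖) + π * (‖x‖ * ‖η‖ ^ 2) := by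
        gcongr
        exact (abs_sub _ _).trans (add_le_add hxη hyz)
    _ ≤ _ := by nlinarith [mul_nonneg hpi.le (mul_nonneg (norm_nonneg x) (sq_nonneg ‖η‖))]

/-- A wave packet of frequency `a²` and length `a⁻¹` in the direction of `e` sweeps out a fixed
open set in time at most `a⁻²`. -/
theorem exists_isOpen_lt_norm_packetIntegral {V : Type*} [NormedAddCommGroup V]
    [InnerProductSpace ℝ V] [FiniteDimensional ℝ V] [MeasurableSpace V] [BorelSpace V] (s : ℝ)
    {e : V} (he : ‖e‖ = 1) :
    ∃ T : Set V, T ⊆ Metric.ball 0 1 ∧ IsOpen T ∧ T.Nonempty ∧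
      ∀ᶠ a : ℝ in atTop, ∀ ha : a ≠ 0, ∀ x ∈ T, ∃ t, 0 < t ∧ t < 1 ∧
        1 / 4 < ‖packetIntegral s t (stretch he ha one_ne_zero) (a ^ 2 • e) x‖ := by
  have hpi := pi_pos
  obtain ⟨J, hJdef⟩ : ∃ J, J = ∫ η : V, (‖η‖ + ‖η‖ ^ 2) * rexp (-π * ‖η‖ ^ 2) := ⟨_, rfl⟩
  have hJ : 0 ≤ J := hJdef ▸ integral_nonneg fun η ↦ by positivity
  -- On the ball of radius `δ` the phase error is at most `1/4`; the symbol error will be below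
  -- `1/4` too, which leaves more than `1/4` of the unit mass.
  obtain ⟨δ, hδ0, hδ1, hδJ⟩ : ∃ δ : ℝ, 0 < δ ∧ δ ≤ 1 ∧ 4 * π * δ * J ≤ 1 / 4 := by
    refine ⟨1 / (16 * π * (J + 1)), by positivity, ?_, ?_⟩
    · rw [div_le_one (by positivity)]
      nlinarith [pi_gt_three]
    · rw [mul_one_div, div_mul_eq_mul_div, div_le_iff₀ (by positivity)]
      nlinarith
  have herr := tendsto_integral_symbolRatio_sub_one_pow (V := V) s
    one_lt_two (fun a ↦ a ^ 2 • e) (fun a ha ↦ by simp [norm_smul, he])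
    (fun a ↦ stretchMap e a 1) (fun a ha ↦ (stretchMap e a 1).continuous)
    (fun a ha η ↦ norm_stretch_le he (α := a) (by positivity) one_ne_zero zero_le_one ha η)
    one_ne_zero
  -- The half ball ahead of the packet, reached at positive times.
  refine ⟨Metric.ball 0 δ ∩ {x | 0 < inner ℝ e x},
    Set.inter_subset_left.trans (Metric.ball_subset_ball hδ1),
    Metric.isOpen_ball.inter (isOpen_lt continuous_const (by fun_prop)),
    ⟨(δ / 2) • e, ?_, ?_⟩, ?_⟩
  · rw [mem_ball_zero_iff, norm_smul, he, Real.norm_of_nonneg (by positivity)]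
    linarith
  · change 0 < inner ℝ e ((δ / 2) • e)
    rw [inner_smul_right, real_inner_self_eq_norm_sq, he]
    positivity
  filter_upwards [eventually_ge_atTop 1, herr.eventually_lt_const (by norm_num : (0 : ℝ) < 1 / 4)]
    with a ha herra ha0 x hx
  have hξ₀ : ‖a ^ 2 • e‖ = a ^ 2 := by simp [norm_smul, he]
  have hx0 : 0 < inner ℝ e x := hx.2
  have hxδ : ‖x‖ < δ := mem_ball_zero_iff.1 hx.1
  have hy : inner ℝ e x ≤ ‖x‖ := by simpa [he] using real_inner_le_norm e x
  refine ⟨inner ℝ e x / (4 * π * a ^ 2), by positivity, ?_, ?_⟩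
  · rw [div_lt_one (by positivity)]
    nlinarith [pi_gt_three, one_le_pow₀ ha (n := 2)]
  · have hwi := integrable_symbolRatio_sub_one_pow s one_lt_two ha (ξ₀ := a ^ 2 • e)
      (by rw [hξ₀, rpow_two]) (stretch he ha0 one_ne_zero).continuous
      (norm_stretch_le he _ _ zero_le_one ha) 1
    simp only [pow_one] at hwi herra
    have h2 := le_norm_integral_exp_mul_gaussian (δ := 4 * π * δ)
      (θ := fun η ↦ schrodingerPhase (inner ℝ e x / (4 * π * a ^ 2)) x
        (a ^ 2 • e + stretch he ha0 one_ne_zero η))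
      (w := fun η ↦ symbolRatio s (a ^ 2 • e) (stretch he ha0 one_ne_zero η))
      (by unfold schrodingerPhase; fun_prop)
      ((continuous_symbolRatio s _).comp (stretch he ha0 one_ne_zero).continuous) hwi
      (fun η ↦ (abs_schrodingerPhase_stretch_sub_le he ha0 ha x η hx0.le).trans (by gcongr))
    rw [← hJdef] at h2
    refine lt_of_lt_of_le ?_ h2
    change _ < 1 - 4 * π * δ * J - ∫ η, |symbolRatio s (a ^ 2 • e) (stretchMap e a 1 η) - 1| *
      rexp (-π * ‖η‖ ^ 2)
    linarith

theorem exists_norm_eq_one_euclideanSpace {n : ℕ} (hn : 1 ≤ n) :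
    ∃ e : EuclideanSpace ℝ (Fin n), ‖e‖ = 1 :=
  ⟨EuclideanSpace.single ⟨0, hn⟩ 1, by simp⟩

/-- The estimate requires `s ≥ 1 / (2p)`. -/
theorem not_weakMaximalEstimate_of_lt_inv {n : ℕ} (hn : 1 ≤ n) {p q s : ℝ} (hp : 1 ≤ p)
    (hq : 1 ≤ q) (hs : s < 1 / (2 * p)) : ¬ WeakMaximalEstimate n p q s := by
  intro hest
  obtain ⟨K, hK⟩ := hest.exists_bound hp hq
  obtain ⟨c, hc, hM⟩ := exists_le_besselSymbol (V := EuclideanSpace ℝ (Fin n)) (-s)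
  obtain ⟨e, he⟩ := exists_norm_eq_one_euclideanSpace hn
  obtain ⟨T, hT, hTo, hTne, hev⟩ := exists_isOpen_lt_norm_packetIntegral s he
  have hTfin : volume T ≠ ⊤ :=
    ((measure_mono hT).trans_lt Metric.isBounded_ball.measure_lt_top).ne
  obtain ⟨μ, hμ, hμT⟩ : ∃ μ : ℝ, 0 < μ ∧ ENNReal.ofReal μ ≤ volume T :=
    ⟨(volume T).toReal, ENNReal.toReal_pos (hTo.measure_pos volume hTne).ne' hTfin,
      ENNReal.ofReal_toReal_le⟩
  have hγ : 0 < 1 / p - 2 * s := by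
    have : 1 / p = 2 * (1 / (2 * p)) := by field_simp
    linarith
  refine not_eventually_mul_rpow_le (c := 1 / 4 * μ ^ (1 / q) * c) (K := K) (by positivity) hγ ?_
  filter_upwards [eventually_ge_atTop 1, hev] with a ha hx
  have ha0 : 0 < a := by linarith
  have hξ₀ : ‖a ^ 2 • e‖ = a ^ 2 := by
    rw [norm_smul, he, mul_one, Real.norm_of_nonneg (by positivity)]
  have hjac : jac (stretch he ha0.ne' one_ne_zero) = a := by
    rw [jac_stretch, one_pow, one_mul, div_one, abs_of_pos ha0]
  have h1 := hK (stretch he ha0.ne' one_ne_zero) (stretch_symm he _ _) (a ^ 2 • e) (1 / 4)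
    μ T (by positivity) hμ.le hT hμT (hx ha0.ne')
  rw [hjac] at h1
  refine le_trans ?_ h1
  have h2 := hM (a ^ 2 • e) (by rw [hξ₀]; exact one_le_pow₀ ha)
  have h3 : a ^ (1 / p - 2 * s) = a ^ (1 / p) * (a ^ 2) ^ (-s) := by
    rw [← rpow_natCast a 2, ← rpow_mul ha0.le, ← rpow_add ha0]
    congr 1
    push_cast
    ring
  rw [hξ₀] at h2
  rw [h3]
  calc _ = 1 / 4 * μ ^ (1 / q) * a ^ (1 / p) * (c * (a ^ 2) ^ (-s)) := by ring
    _ ≤ _ := by gcongr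

/-! ### The `L²` error and the exact Gaussian integral -/

section PacketError

variable {V : Type*} [NormedAddCommGroup V] [InnerProductSpace ℝ V] [FiniteDimensional ℝ V]
  [MeasurableSpace V] [BorelSpace V]

/-- Plancherel's theorem for the error made in freezing the symbol of `(1 - Δ)^{-s/2}`. -/
theorem exists_schwartz_packet_error (s t : ℝ) (A : V ≃L[ℝ] V) (ξ₀ : V) :
    ∃ v : 𝓢(V, ℂ), (∀ x, v x = ∫ η, Complex.exp ((schrodingerPhase t x (ξ₀ + A η) : ℝ) * Complex.I) *
      (((symbolRatio s ξ₀ (A η) - 1) * rexp (-π * ‖η‖ ^ 2) : ℝ) : ℂ)) ∧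
      ∫ x, ‖v x‖ ^ 2
        = (jac A)⁻¹ * ∫ η, |symbolRatio s ξ₀ (A η) - 1| ^ 2 * rexp (-π * ‖η‖ ^ 2) ^ 2 := by
  have hD := jac_pos A
  have hM := besselSymbol_pos (-s) ξ₀
  -- The unimodular propagator times the symbol error, so that the error is the inverse transform of
  -- a Schwartz function and the propagator drops out of its `L²` norm.
  set m : V → ℂ := fun ξ ↦ Complex.exp ((-(4 * π ^ 2 * t) * ‖ξ‖ ^ 2 : ℝ) * Complex.I) *
    ((((besselSymbol (-s) ξ₀)⁻¹ : ℝ) : ℂ) * ((besselSymbol (-s) ξ : ℝ) : ℂ) - 1) with hmdef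
  have hq : (fun ξ : V ↦ -(4 * π ^ 2 * t) * ‖ξ‖ ^ 2).HasTemperateGrowth := by fun_prop
  have hm : m.HasTemperateGrowth :=
    (hasTemperateGrowth_cexp_ofReal_mul_I.comp hq).mul
      (((Function.HasTemperateGrowth.const _).mul (besselSymbol_hasTemperateGrowth (-s))).sub
        (Function.HasTemperateGrowth.const 1))
  set W : 𝓢(V, ℂ) := SchwartzMap.smulLeftCLM ℂ m (gaussianBump A ξ₀) with hW
  have hWA : ∀ η, W (ξ₀ + A η) = Complex.exp ((-(4 * π ^ 2 * t) * ‖ξ₀ + A η‖ ^ 2 : ℝ) * Complex.I) *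
      (((symbolRatio s ξ₀ (A η) - 1) * rexp (-π * ‖η‖ ^ 2) : ℝ) : ℂ) := by
    intro η
    rw [hW, SchwartzMap.smulLeftCLM_apply_apply hm, gaussianBump_apply_affine, smul_eq_mul, hmdef,
      symbolRatio, div_eq_inv_mul]
    push_cast
    ring
  refine ⟨((jac A)⁻¹ : ℝ) • 𝓕⁻ W, fun x ↦ ?_, ?_⟩
  · rw [smul_apply, SchwartzMap.fourierInv_coe, Real.fourierInv_eq',
      integral_comp_affine A ξ₀, smul_smul, inv_mul_cancel₀ hD.ne', one_smul]
    congr 1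
    funext η
    rw [hWA, smul_eq_mul, ← mul_assoc, ← Complex.exp_add, schrodingerPhase,
      real_inner_comm x (ξ₀ + A η)]
    congr 2
    push_cast
    ring
  · have h1 : ∫ x, ‖(𝓕⁻ W : 𝓢(V, ℂ)) x‖ ^ 2 = ∫ ξ, ‖W ξ‖ ^ 2 := by
      rw [← SchwartzMap.integral_norm_sq_fourier, FourierTransform.fourier_fourierInv_eq]
    have h2 : ∀ x, ‖(((jac A)⁻¹ : ℝ) • (𝓕⁻ W : 𝓢(V, ℂ))) x‖ ^ 2
        = (jac A)⁻¹ ^ 2 * ‖(𝓕⁻ W : 𝓢(V, ℂ)) x‖ ^ 2 := fun x ↦ by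
      rw [smul_apply, norm_smul, mul_pow, Real.norm_of_nonneg (by positivity)]
    simp_rw [h2]
    rw [integral_const_mul, h1, integral_comp_affine A ξ₀, smul_eq_mul, ← mul_assoc]
    congr 1
    · field_simp
    · congr 1
      funext η
      rw [hWA, norm_mul, Complex.norm_exp_ofReal_mul_I, one_mul, Complex.norm_real, norm_mul,
        mul_pow, Real.norm_eq_abs, Real.norm_of_nonneg (exp_pos _).le]

theorem volume_norm_ge_le (v : 𝓢(V, ℂ)) {δ : ℝ} (hδ : 0 < δ) :
    volume {x | δ ≤ ‖v x‖} ≤ ENNReal.ofReal (δ⁻¹ ^ 2 * ∫ x, ‖v x‖ ^ 2) := by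
  have hi : Integrable (fun x ↦ ‖v x‖ ^ 2) := (v.memLp 2 volume).integrable_norm_pow (by norm_num)
  have h1 := mul_meas_ge_le_integral_of_nonneg (Eventually.of_forall fun x ↦ by positivity) hi
    (δ ^ 2)
  have h2 : {x | δ ^ 2 ≤ ‖v x‖ ^ 2} = {x | δ ≤ ‖v x‖} := by
    ext x
    exact pow_le_pow_iff_left₀ hδ.le (norm_nonneg _) two_ne_zero
  have hfin : volume {x | δ ≤ ‖v x‖} ≠ ⊤ := by
    rw [← h2]
    exact (hi.measure_ge_lt_top (by positivity)).ne
  rw [h2] at h1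
  rw [← ENNReal.ofReal_toReal hfin]
  refine ENNReal.ofReal_le_ofReal ?_
  rw [inv_pow, ← div_eq_inv_mul, le_div_iff₀' (by positivity)]
  exact h1

/-- A Gaussian integral with complex parameter `π(1 + iτ)`: dispersion lowers the height and widens
the profile by `√(1 + τ²)`. -/
theorem norm_integral_exp_phase_mul_gaussian {τ : ℝ} (c : ℝ) (y : V) (θ : V → ℝ)
    (hθ : ∀ η, θ η = c + 2 * π * inner ℝ y η - π * τ * ‖η‖ ^ 2) :
    ‖∫ η : V, Complex.exp ((θ η : ℝ) * Complex.I) * ((rexp (-π * ‖η‖ ^ 2) : ℝ) : ℂ)‖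
      = (√(1 + τ ^ 2))⁻¹ ^ ((Module.finrank ℝ V : ℝ) / 2) * rexp (-π * ‖y‖ ^ 2 / (1 + τ ^ 2)) := by
  have hpi : (π : ℂ) ≠ 0 := by exact_mod_cast pi_ne_zero
  have hb : 0 < ((π : ℂ) * (1 + τ * Complex.I)).re := by simpa using pi_pos
  have h1 : ∀ η : V, Complex.exp ((θ η : ℝ) * Complex.I) * ((rexp (-π * ‖η‖ ^ 2) : ℝ) : ℂ)
      = Complex.exp (c * Complex.I) * Complex.exp (-((π : ℂ) * (1 + τ * Complex.I)) * ‖η‖ ^ 2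
        + (2 * π * Complex.I) * inner ℝ y η) := by
    intro η
    rw [hθ, Complex.ofReal_exp, ← Complex.exp_add, ← Complex.exp_add]
    congr 1
    push_cast
    ring
  simp_rw [h1]
  have hz : (1 + τ * Complex.I) ≠ 0 := fun h ↦ by simpa using congrArg Complex.re h
  have hzn : ‖(1 + τ * Complex.I)‖ = √(1 + τ ^ 2) := by
    have := Complex.norm_add_mul_I 1 τ
    simpa using this
  rw [integral_const_mul, GaussianFourier.integral_cexp_neg_mul_sq_norm_add hb, norm_mul, norm_mul,
    Complex.norm_exp_ofReal_mul_I, one_mul, Complex.norm_exp]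
  congr 1
  · have h2 : ((Module.finrank ℝ V : ℂ) / 2) = (((Module.finrank ℝ V : ℝ) / 2 : ℝ) : ℂ) := by
      push_cast; ring
    rw [h2, Complex.norm_cpow_real]
    congr 1
    rw [← div_div, div_self hpi, norm_div, hzn, norm_one, one_div]
  · congr 1
    have h3 : (2 * π * Complex.I) ^ 2 * (‖y‖ : ℂ) ^ 2 / (4 * (π * (1 + τ * Complex.I)))
        = ((-π * ‖y‖ ^ 2 / (1 + τ ^ 2) : ℝ) : ℂ) * (1 - τ * Complex.I) := by
      have h5 : ((1 + τ ^ 2 : ℝ) : ℂ) = (1 + τ * Complex.I) * (1 - τ * Complex.I) := by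
        push_cast
        linear_combination (τ : ℂ) ^ 2 * Complex.I_sq
      have h6 : (1 - τ * Complex.I) ≠ 0 := fun h ↦ by simpa using congrArg Complex.re h
      rw [Complex.ofReal_div, h5, div_mul_eq_mul_div, div_eq_div_iff
        (by simp [hpi, hz]) (mul_ne_zero hz h6)]
      push_cast
      linear_combination (4 * (π : ℂ) ^ 2 * (‖y‖ : ℂ) ^ 2 * (1 + τ * Complex.I) *
        (1 - τ * Complex.I)) * Complex.I_sq
    rw [h3, Complex.re_ofReal_mul]
    simp

theorem le_norm_integral_exp_phase_mul_gaussian {τ : ℝ} (hτ : 1 ≤ τ) (c : ℝ) {y : V} (hy : ‖y‖ ≤ τ)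
    (θ : V → ℝ) (hθ : ∀ η, θ η = c + 2 * π * inner ℝ y η - π * τ * ‖η‖ ^ 2) :
    (2 * τ)⁻¹ ^ ((Module.finrank ℝ V : ℝ) / 2) * rexp (-π) ≤
    ‖∫ η : V, Complex.exp ((θ η : ℝ) * Complex.I) * ((rexp (-π * ‖η‖ ^ 2) : ℝ) : ℂ)‖ := by
  rw [norm_integral_exp_phase_mul_gaussian c y θ hθ]
  have h1 : √(1 + τ ^ 2) ≤ 2 * τ := by
    rw [sqrt_le_left (by positivity)]
    nlinarith
  have h2 : ‖y‖ ^ 2 / (1 + τ ^ 2) ≤ 1 := by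
    rw [div_le_one (by positivity)]
    nlinarith [norm_nonneg y]
  gcongr
  rw [mul_div_assoc]
  nlinarith [pi_pos]

end PacketError

/-! ### The spreading packet -/

section Spreading

variable {V : Type*} [NormedAddCommGroup V] [InnerProductSpace ℝ V]

/-- The group velocity is `4πR e`, so at time `1/(8πR)` the packet is centred at `e/2`, with
dispersion parameter `τ = a²/(2R)`. -/
theorem schrodingerPhase_dilation {e : V} (he : ‖e‖ = 1) {a R : ℝ} (ha : a ≠ 0) (hR : R ≠ 0)
    (x η : V) :
    schrodingerPhase (1 / (8 * π * R)) x (R • e + stretch he ha ha η)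
      = (2 * π * R * inner ℝ x e - π / 2 * R) + 2 * π * inner ℝ (a • (x - (1 / 2 : ℝ) • e)) η
        - π * (a ^ 2 / (2 * R)) * ‖η‖ ^ 2 := by
  have hpi := pi_ne_zero
  rw [schrodingerPhase, norm_add_sq_real, norm_sq_stretch, stretch_apply, norm_smul, he,
    Real.norm_eq_abs, mul_one, sq_abs]
  simp only [inner_add_right, inner_smul_right, inner_smul_left, inner_sub_left, sub_self, zero_mul,
    zero_smul, inner_zero_right]
  simp
  field_simp
  ring

variable [FiniteDimensional ℝ V] [MeasurableSpace V] [BorelSpace V]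

theorem integrable_exp_ofReal_mul_I_mul {θ f : V → ℝ} (hθ : Continuous θ) (hf : Integrable f) :
    Integrable fun η ↦ Complex.exp ((θ η : ℝ) * Complex.I) * ((f η : ℝ) : ℂ) := by
  have h1 : Continuous fun η ↦ Complex.exp ((θ η : ℝ) * Complex.I) :=
    ((Complex.continuous_ofReal.comp hθ).mul continuous_const).cexp
  refine hf.norm.mono' (h1.aestronglyMeasurable.mul hf.ofReal.1) (Eventually.of_forall fun η ↦ ?_)
  rw [norm_mul, Complex.norm_exp_ofReal_mul_I, one_mul, Complex.norm_real]

theorem packetIntegral_eq_add {s t κ a : ℝ} (hκ : 1 < κ) (ha : 1 ≤ a) {A : V ≃L[ℝ] V} {ξ₀ : V}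
    (hξ₀ : ‖ξ₀‖ = a ^ κ) (hA : ∀ η, ‖A η‖ ≤ a * ‖η‖) (x : V) :
    packetIntegral s t A ξ₀ x =
      (∫ η, Complex.exp ((schrodingerPhase t x (ξ₀ + A η) : ℝ) * Complex.I) *
        ((rexp (-π * ‖η‖ ^ 2) : ℝ) : ℂ)) +
      ∫ η, Complex.exp ((schrodingerPhase t x (ξ₀ + A η) : ℝ) * Complex.I) *
        (((symbolRatio s ξ₀ (A η) - 1) * rexp (-π * ‖η‖ ^ 2) : ℝ) : ℂ) := by
  have hθ : Continuous fun η ↦ schrodingerPhase t x (ξ₀ + A η) := by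
    unfold schrodingerPhase; fun_prop
  have hw := (continuous_symbolRatio s ξ₀).comp A.continuous
  have h1 := integrable_symbolRatio_sub_one_pow s hκ ha hξ₀ A.continuous hA 1
  have h2 : Integrable fun η ↦ (symbolRatio s ξ₀ (A η) - 1) * rexp (-π * ‖η‖ ^ 2) := by
    refine h1.mono' (Continuous.aestronglyMeasurable
      ((hw.sub continuous_const).mul (by fun_prop))) (Eventually.of_forall fun η ↦ ?_)
    rw [norm_mul, pow_one, Real.norm_eq_abs, Real.norm_of_nonneg (exp_pos _).le]
  rw [← integral_add (integrable_exp_ofReal_mul_I_mul hθ integrable_gaussian)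
    (integrable_exp_ofReal_mul_I_mul hθ h2), packetIntegral]
  congr 1
  funext η
  push_cast
  ring

theorem ofReal_mul_le_volume_ball_diff {z : V} {ρ C : ℝ} (hρ : 0 < ρ) {S : Set V} (hC : 0 ≤ C)
    (hS : volume S ≤ ENNReal.ofReal (ρ ^ Module.finrank ℝ V * C))
    (hCV : 2 * C ≤ (volume (Metric.ball (0 : V) 1)).toReal) :
    ENNReal.ofReal ((volume (Metric.ball (0 : V) 1)).toReal / 2 * ρ ^ Module.finrank ℝ V)
      ≤ volume (Metric.ball z ρ \ S) := by
  refine le_trans ?_ le_measure_sdiff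
  rw [Measure.addHaar_ball_of_pos volume z hρ,
    ← ENNReal.ofReal_toReal (Metric.isBounded_ball (x := (0 : V)) (r := 1)).measure_lt_top.ne,
    ← ENNReal.ofReal_mul (by positivity)]
  refine le_trans ?_ (tsub_le_tsub_left hS _)
  rw [← ENNReal.ofReal_sub _ (by positivity)]
  refine ENNReal.ofReal_le_ofReal ?_
  rw [ENNReal.toReal_ofReal ENNReal.toReal_nonneg]
  have : 0 < ρ ^ Module.finrank ℝ V := by positivity
  nlinarith

/-- At time `≈ 1 / R`, a wave packet of frequency `R = a^κ` and length `a⁻¹` has spread out over a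
ball of radius `a / (2R)`. -/
theorem exists_spreading_set (s : ℝ) {κ : ℝ} (hκ : 1 < κ) (hκ2 : κ < 2) {e : V} (he : ‖e‖ = 1) :
    ∃ c : ℝ, 0 < c ∧ ∀ᶠ a : ℝ in atTop, ∀ ha : a ≠ 0, ∃ T : Set V, T ⊆ Metric.ball 0 1 ∧
      ENNReal.ofReal (c * (a / (2 * a ^ κ)) ^ Module.finrank ℝ V) ≤ volume T ∧
      ∀ x ∈ T, ∃ t, 0 < t ∧ t < 1 ∧
        rexp (-π) / 2 * (a ^ 2 / a ^ κ)⁻¹ ^ ((Module.finrank ℝ V : ℝ) / 2)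
          < ‖packetIntegral s t (stretch he ha ha) (a ^ κ • e) x‖ := by
  have hpi := pi_pos
  have hV : 0 < (volume (Metric.ball (0 : V) 1)).toReal :=
    ENNReal.toReal_pos (Metric.measure_ball_pos volume _ one_pos).ne'
      Metric.isBounded_ball.measure_lt_top.ne
  -- The constant for which Chebyshev bounds the exceptional set by `(a/(2R))^n · B · E`, with `E`
  -- the squared symbol error.
  obtain ⟨B, hBdef⟩ : ∃ B, B = (rexp (-π) / 2)⁻¹ ^ 2 * 2 ^ Module.finrank ℝ V := ⟨_, rfl⟩
  have hB : 0 < B := by rw [hBdef]; positivity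
  have hnorm : ∀ a : ℝ, 1 ≤ a → ‖a ^ κ • e‖ = a ^ κ := fun a ha ↦ by
    rw [norm_smul, he, mul_one, Real.norm_of_nonneg (by positivity)]
  have herr := tendsto_integral_symbolRatio_sub_one_pow (V := V) s hκ (fun a ↦ a ^ κ • e) hnorm
    (fun a ↦ stretchMap e a a) (fun a ha ↦ (stretchMap e a a).continuous)
    (fun a ha η ↦ norm_stretch_le he (α := a) (by positivity) (by positivity) (by positivity)
      le_rfl η) two_ne_zero
  have hτlim : ∀ᶠ a : ℝ in atTop, 2 ≤ a ^ (2 - κ) :=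
    (tendsto_rpow_atTop (by linarith)).eventually_ge_atTop 2
  refine ⟨(volume (Metric.ball (0 : V) 1)).toReal / 2, by positivity, ?_⟩
  filter_upwards [eventually_ge_atTop 1, hτlim, herr.eventually_lt_const
    (by positivity : 0 < (volume (Metric.ball (0 : V) 1)).toReal / (2 * B))] with a ha hτ2 herra ha0
  have hapos : 0 < a := by linarith
  have haκ : a ≤ a ^ κ := by
    conv_lhs => rw [← rpow_one a]
    exact rpow_le_rpow_of_exponent_le ha hκ.le
  rw [rpow_sub hapos, rpow_two] at hτ2
  have hξ₀ := hnorm a ha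
  obtain ⟨R, hRdef⟩ : ∃ R, R = a ^ κ := ⟨_, rfl⟩
  rw [← hRdef] at haκ hτ2 hξ₀ herra ⊢
  have hR : 0 < R := by linarith
  have hjac : jac (stretch he ha0 ha0) = a ^ Module.finrank ℝ V := by
    rw [jac_stretch, div_self ha0, mul_one, abs_of_pos (by positivity)]
  obtain ⟨v, hv, hv2⟩ := exists_schwartz_packet_error s (1 / (8 * π * R)) (stretch he ha0 ha0)
    (R • e)
  have hstr := norm_stretch_le he ha0 ha0 hapos.le le_rfl
  set δ := rexp (-π) / 2 * (a ^ 2 / R)⁻¹ ^ ((Module.finrank ℝ V : ℝ) / 2) with hδdef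
  have hδ : 0 < δ := by positivity
  obtain ⟨E, hEdef⟩ : ∃ E, E = ∫ η : V, |symbolRatio s (R • e) (stretchMap e a a η) - 1| ^ 2 *
      rexp (-π * ‖η‖ ^ 2) := ⟨_, rfl⟩
  rw [← hEdef] at herra
  have hE0 : 0 ≤ E := hEdef ▸ integral_nonneg fun η ↦ by positivity
  have hvE : ∫ x, ‖v x‖ ^ 2 ≤ (a ^ Module.finrank ℝ V)⁻¹ * E := by
    rw [hv2, hjac, hEdef]
    refine mul_le_mul_of_nonneg_left ?_ (by positivity)
    refine integral_mono_of_nonneg (Eventually.of_forall fun η ↦ by positivity)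
      (integrable_symbolRatio_sub_one_pow s hκ ha (hξ₀.trans hRdef)
        (stretchMap e a a).continuous hstr 2) (Eventually.of_forall fun η ↦ ?_)
    refine mul_le_mul_of_nonneg_left ?_ (by positivity)
    refine pow_le_of_le_one (exp_pos _).le (exp_le_one_iff.2 ?_) two_ne_zero
    nlinarith [sq_nonneg ‖η‖]
  have hbad : volume {x | δ ≤ ‖v x‖}
      ≤ ENNReal.ofReal ((a / (2 * R)) ^ Module.finrank ℝ V * (B * E)) := by
    refine (volume_norm_ge_le v hδ).trans (ENNReal.ofReal_le_ofReal ?_)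
    have h1 : δ⁻¹ ^ 2 = (rexp (-π) / 2)⁻¹ ^ 2 * (a ^ 2 / R) ^ Module.finrank ℝ V := by
      rw [hδdef, mul_inv, mul_pow, inv_rpow (by positivity), inv_inv]
      congr 1
      rw [← rpow_mul_natCast (by positivity), Nat.cast_ofNat, div_mul_cancel₀ _ two_ne_zero,
        rpow_natCast]
    -- The factor `(a²/R)^n` in `δ⁻²` meets `a^{-n}` from Plancherel and gives `(a/R)^n`, the scale
    -- of the ball's volume; smallness of `E` then suffices.
    calc _ ≤ δ⁻¹ ^ 2 * ((a ^ Module.finrank ℝ V)⁻¹ * E) := by gcongr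
      _ = _ := by
        rw [h1, hBdef]
        simp only [div_pow, mul_pow, ← pow_mul, mul_comm 2]
        rw [pow_mul, ← mul_pow]
        field_simp
        rw [mul_pow]
        ring
  refine ⟨Metric.ball ((1 / 2 : ℝ) • e) (a / (2 * R)) \ {x | δ ≤ ‖v x‖}, ?_,
    ofReal_mul_le_volume_ball_diff (by positivity) (by positivity) hbad ?_, ?_⟩
  · refine Set.sdiff_subset.trans fun x hx ↦ ?_
    rw [mem_ball_iff_norm] at hx
    rw [mem_ball_zero_iff]
    have h1 : a / (2 * R) ≤ 1 / 2 := by rw [div_le_div_iff₀ (by positivity) two_pos]; linarith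
    have h2 : ‖(1 / 2 : ℝ) • e‖ = 1 / 2 := by rw [norm_smul, he]; norm_num
    have h3 := norm_sub_norm_le x ((1 / 2 : ℝ) • e)
    linarith
  · rw [lt_div_iff₀ (by positivity)] at herra
    linarith
  · rintro x ⟨hx, hxv⟩
    have hxv' : ‖v x‖ < δ := not_le.1 hxv
    rw [mem_ball_iff_norm] at hx
    refine ⟨1 / (8 * π * R), by positivity, ?_, ?_⟩
    · rw [div_lt_one (by positivity)]
      nlinarith [pi_gt_three]
    · have h1 := packetIntegral_eq_add (s := s) (t := 1 / (8 * π * R)) hκ ha (hξ₀.trans hRdef)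
        hstr x
      rw [← hv x] at h1
      have hτ : 1 ≤ a ^ 2 / (2 * R) := by
        rw [le_div_iff₀ (by positivity)]
        rw [le_div_iff₀ hR] at hτ2
        linarith
      have hy : ‖a • (x - (1 / 2 : ℝ) • e)‖ ≤ a ^ 2 / (2 * R) := by
        rw [norm_smul, Real.norm_of_nonneg hapos.le]
        calc _ ≤ a * (a / (2 * R)) := by gcongr
          _ = _ := by ring
      have h2 := le_norm_integral_exp_phase_mul_gaussian hτ _ hy _
        (schrodingerPhase_dilation he ha0 hR.ne' x)
      have h3 : 2 * (a ^ 2 / (2 * R)) = a ^ 2 / R := by field_simp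
      rw [h3] at h2
      have h4 := norm_sub_le_norm_add
        (∫ η : V, Complex.exp ((schrodingerPhase (1 / (8 * π * R)) x
          (R • e + stretch he ha0 ha0 η) : ℝ) * Complex.I) * ((rexp (-π * ‖η‖ ^ 2) : ℝ) : ℂ)) (v x)
      rw [← h1] at h4
      -- The main term is at least `2δ` and the error is below `δ` off the exceptional set.
      have h5 : (a ^ 2 / R)⁻¹ ^ ((Module.finrank ℝ V : ℝ) / 2) * rexp (-π) = 2 * δ := by
        rw [hδdef]; ring
      linarith

end Spreading

/-! ### Choice of exponents and conclusion -/

theorem exists_one_lt_lt_two_mul_lt {b d : ℝ} (h : b < d) :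
    ∃ κ : ℝ, 1 < κ ∧ κ < 2 ∧ κ * b < d := by
  have h1 : Tendsto (fun κ : ℝ ↦ κ * b) (𝓝[>] 1) (𝓝 (1 * b)) :=
    ((continuous_id.mul continuous_const).tendsto (1 : ℝ)).mono_left nhdsWithin_le_nhds
  rw [one_mul] at h1
  obtain ⟨κ, h2, h3⟩ := ((h1.eventually_lt_const h).and
    (Ioo_mem_nhdsGT (one_lt_two : (1 : ℝ) < 2))).exists
  exact ⟨κ, h3.1, h3.2, h2⟩

/-- The estimate requires `s ≥ n (1 / p - 1 / 2)`. -/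
theorem not_weakMaximalEstimate_of_lt_mul_sub {n : ℕ} (hn : 1 ≤ n) {p q s : ℝ} (hp : 1 ≤ p)
    (hq : 1 ≤ q) (hs : s < n * (1 / p - 1 / 2)) : ¬ WeakMaximalEstimate n p q s := by
  intro hest
  obtain ⟨K, hK⟩ := hest.exists_bound hp hq
  obtain ⟨c, hc, hM⟩ := exists_le_besselSymbol (V := EuclideanSpace ℝ (Fin n)) (-s)
  obtain ⟨e, he⟩ := exists_norm_eq_one_euclideanSpace hn
  have hn0 : (0 : ℝ) < n := by exact_mod_cast hn
  obtain ⟨κ, hκ1, hκ2, hκ⟩ := exists_one_lt_lt_two_mul_lt (b := n / 2 + s) (d := n / p)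
    (by rw [mul_sub, mul_one_div, mul_one_div] at hs; linarith)
  obtain ⟨c₀, hc₀, hev⟩ := exists_spreading_set s hκ1 hκ2 he
  simp only [finrank_euclideanSpace_fin] at hev
  refine not_eventually_mul_rpow_le
    (c := rexp (-π) / 2 * (c₀ * (1 / 2) ^ n) ^ (1 / q) * c) (K := K)
    (γ := n / p - κ * (n / 2 + s)) (by positivity) (by linarith) ?_
  filter_upwards [eventually_ge_atTop 1, hev] with a ha hT
  have hapos : 0 < a := by linarith
  obtain ⟨T, hT1, hTv, hTx⟩ := hT hapos.ne'
  have hξ₀ : ‖a ^ κ • e‖ = a ^ κ := by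
    rw [norm_smul, he, mul_one, Real.norm_of_nonneg (by positivity)]
  have hjac : jac (stretch he hapos.ne' hapos.ne') = a ^ (n : ℝ) := by
    rw [jac_stretch, div_self hapos.ne', mul_one, abs_of_pos (by positivity),
      finrank_euclideanSpace_fin, rpow_natCast]
  have h1 := hK _ (stretch_symm he hapos.ne' hapos.ne') _ _ _ T (by positivity) (by positivity)
    hT1 hTv hTx
  refine le_trans ?_ h1
  have h2 := hM (a ^ κ • e) (by rw [hξ₀]; exact one_le_rpow ha (by linarith))
  rw [hξ₀, ← rpow_mul hapos.le] at h2
  have h3 : (a ^ 2 / a ^ κ)⁻¹ ^ ((n : ℝ) / 2) = a ^ ((κ - 2) * (n / 2)) := by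
    rw [inv_div, ← rpow_two, ← rpow_sub hapos, ← rpow_mul hapos.le]
  have h4 : (c₀ * (a / (2 * a ^ κ)) ^ n) ^ (1 / q)
      = (c₀ * (1 / 2) ^ n) ^ (1 / q) * a ^ ((1 - κ) * n * (1 / q)) := by
    have h5 : a / (2 * a ^ κ) = 1 / 2 * a ^ (1 - κ) := by
      rw [rpow_sub hapos, rpow_one]; field_simp
    rw [h5, mul_pow, ← mul_assoc, mul_rpow (by positivity) (by positivity), ← rpow_natCast (a ^ _),
      ← rpow_mul hapos.le, ← rpow_mul hapos.le]
  -- The measure factor is smallest for `q = 1`; its loss `a^{(1-κ)n}` is harmless since `κ` is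
  -- close to `1`.
  have h6 : (1 - κ) * n ≤ (1 - κ) * n * (1 / q) := by
    have : 1 / q ≤ 1 := by rw [div_le_one (by linarith)]; exact hq
    nlinarith [mul_nonneg (by linarith : 0 ≤ κ - 1) hn0.le]
  rw [h3, h4, hjac, ← rpow_mul hapos.le]
  calc _ = rexp (-π) / 2 * a ^ ((κ - 2) * (n / 2)) *
        ((c₀ * (1 / 2) ^ n) ^ (1 / q) * a ^ ((1 - κ) * n)) * a ^ (n * (1 / p)) *
        (c * a ^ (κ * -s)) := by
        have : a ^ (n / p - κ * (n / 2 + s)) = a ^ ((κ - 2) * (n / 2)) * a ^ ((1 - κ) * n) *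
            a ^ (n * (1 / p)) * a ^ (κ * -s) := by
          rw [← rpow_add hapos, ← rpow_add hapos, ← rpow_add hapos]
          congr 1
          ring
        rw [this]
        ring
    _ ≤ _ := by gcongr

/-- The weak-type maximal estimate fails: no constant works for all `f ∈ L^p_s`, not even for all
Schwartz functions `f` (for which the integral defining `e^{itΔ} f` converges absolutely). -/
theorem theorem1p8 (n : ℕ) (p q s : ℝ) (hp : 1 ≤ p) (hq : 1 ≤ q)
    (h : (n = 1 ∧ s < 1 / (2 * p)) ∨
      (2 ≤ n ∧ p < 2 ∧ s < n * (1 / p - 1 / 2)) ∨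
      (2 ≤ n ∧ 2 ≤ p ∧ p < (2 * (n : ℝ) - 1) / ((n : ℝ) - 1) ∧
        s < (1 / 2 - (n : ℝ)) * (1 / 2 - 1 / p) + 1 / 4)) :
    ¬ ∃ C : ℝ≥0, ∀ f : 𝓢(EuclideanSpace ℝ (Fin n), ℂ),
      MemBesselSpace s (ENNReal.ofReal p) (f : 𝓢'(EuclideanSpace ℝ (Fin n), ℂ)) →
      weakNormOn q (Metric.ball (0 : EuclideanSpace ℝ (Fin n)) 1) (schrodingerMaximal f) ≤
        C * besselNorm s (ENNReal.ofReal p) (f : 𝓢'(EuclideanSpace ℝ (Fin n), ℂ)) := by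
  rcases h with ⟨hn, hs⟩ | ⟨hn, -, hs⟩ | ⟨hn, hp2, -, hs⟩
  · exact not_weakMaximalEstimate_of_lt_inv hn.ge hp hq hs
  · exact not_weakMaximalEstimate_of_lt_mul_sub (by omega) hp hq hs
  -- With `u = 1/2 - 1/p ≥ 0` the third threshold equals `1/(2p) - (n - 1)u`, so the travelling
  -- packet covers it.
  · refine not_weakMaximalEstimate_of_lt_inv (by omega) hp hq (hs.trans_le ?_)
    have hn' : (2 : ℝ) ≤ n := by exact_mod_cast hn
    have h1 : 0 ≤ 1 / 2 - 1 / p := by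
      rw [sub_nonneg]
      exact one_div_le_one_div_of_le two_pos hp2
    have h2 : 1 / (2 * p) = 1 / 2 * (1 / p) := by field_simp
    rw [h2]
    nlinarith
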